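/- **Setting.** Let $S^3=\{(z_0,z_1)\in\mathbb C^2: |z_0|^2+|z_1|^2=1\}$, let $\theta_j=\arg z_j$, and let indices be modulo $2$. Let $A_i=\{z_i=0\}$, $\rho_i=2|z_i|/|z_{i+1}|$ and, for $0\le r\le 2$, $K_i^r=\{\rho_i\le r\}$. The map $(z_0,z_1)\mapsto(z_{i+1}/|z_{i+1}|,\,2z_i/|z_{i+1}|)$ identifies $K_i^r$ with $S^1\times D^2(r)$, where $D^2(r)$ is the closed disc of radius $r$. Thus $S^3=K_0^2\cup K_1^2$ is obtained by pasting two solid tori along their boundary torus, meridians to longitudes. A smooth $1$-dimensional foliation $\mathcal F^0$ of $S^3$ is called a *Candel–Conlon foliation* if * for $i=0,1$, the axis $A_i$ is a leaf of $\mathcal F^0$; there is a smooth function $f_i:(0,\infty)\to\mathbb R$ with $|f_i(\rho)|\to\infty$ as $\rho\to0$ such that on $K_i^2\setminus A_i$ the foliation $\mathcal F^0$ is tangent to the trumpets $\theta_{i+1}=c+f_i(\rho_i)$ (the leaves of a turbulization of the product foliation of the solid torus by discs along its axis); and $\mathcal F^0$ is transverse to the boundary torus $|z_0|=|z_1|$;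 * on $S^3\setminus(A_0\cup A_1)$ the leaves of $\mathcal F^0$ are transverse to the $1$-form $d\theta_0+d\theta_1$, i.e. this form does not vanish on their nonzero tangent vectors. For $t\in[0,1]$ let $k_t$ be a smooth increasing diffeomorphism from $\{u>0: t/2<u,\ tu<2\}$ onto $(0,\infty)$, with $k_0=\mathrm{id}$. Let $\Psi_t:S^3\setminus(K_0^t\cup K_1^t)\to S^3\setminus(A_0\cup A_1)$ be the diffeomorphism that preserves $\theta_0,\theta_1$ and changes $u=|z_0|/|z_1|$ into $k_t(u)$. Let $\mathcal F^t$ be obtained from $\mathcal F^0$ by replacing the axis leaves $A_0,A_1$ by the solid tori $K_0^t,K_1^t$ of radius $t$ with the product foliation by the circles $S^1\times\{q\}$, $q\in D^2(t)$; that is, $\mathcal F^t$ is this product foliation on $K_i^t$ and $\Psi_t^*\mathcal F^0$ on the complement. Suppose that the choices are made such that $\{\mathcal F^t\}_{t\in[0,1]}$ is a smooth family of $1$-dimensional foliations of $S^3$ (locally spanned by nowhere vanishing vector fields depending smoothly on the point and on $t$ jointly). **Proposition.** For every $t\in[0,1]$ with $t\ne0$, $\mathcal F^t$ is minimizable: there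 is a smooth Riemannian metric on $S^3$ for which every leaf of $\mathcal F^t$ is a minimal submanifold. -/

import Mathlib

open Set Filter Topology Bundle
open scoped Manifold ContDiff

noncomputable section

/-! ### One-dimensional foliations and minimizability on a smooth manifold -/

section General

/-- A field of tangent subspaces on an `n`-manifold. -/
abbrev TangentDistribution (n : ℕ) (M : Type*) [TopologicalSpace M]
    [ChartedSpace (EuclideanSpace ℝ (Fin n)) M] : Type _ :=
  ∀ x : M, Submodule ℝ (TangentSpace (𝓡 n) x)

/-- The field of lines `L` is (the tangent field of) a smooth one-dimensional foliation: near every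
point it is spanned by a nowhere vanishing smooth vector field. A field of lines is always
integrable; the leaves are the integral curves of these vector fields. -/
def IsFoliationOne {n : ℕ} {M : Type*} [TopologicalSpace M]
    [ChartedSpace (EuclideanSpace ℝ (Fin n)) M] [IsManifold (𝓡 n) ∞ M] (L : TangentDistribution n M) : Prop :=
  ∀ x₀ : M, ∃ U : Set M, IsOpen U ∧ x₀ ∈ U ∧
    ∃ X : ∀ x : M, TangentSpace (𝓡 n) x,
      ContMDiffOn (𝓡 n) (𝓡 n).tangent ∞ (fun x => (⟨x, X x⟩ : TangentBundle (𝓡 n) M)) U ∧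
      ∀ x ∈ U, X x ≠ 0 ∧ L x = Submodule.span ℝ {X x}

/-- `(L t)`, `t ∈ J`, is a smooth family of one-dimensional foliations: near every point of `M × J`
there are nowhere vanishing spanning vector fields of the `L t` depending smoothly on the point and
on the parameter jointly. -/
def IsSmoothFamilyOne {n : ℕ} {M : Type*} [TopologicalSpace M]
    [ChartedSpace (EuclideanSpace ℝ (Fin n)) M] [IsManifold (𝓡 n) ∞ M]
    (J : Set ℝ) (L : ℝ → TangentDistribution n M) : Prop :=
  ∀ x₀ : M, ∀ t₀ ∈ J, ∃ W : Set (M × ℝ), IsOpen W ∧ (x₀, t₀) ∈ W ∧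
    ∃ X : ∀ p : M × ℝ, TangentSpace (𝓡 n) p.1,
      ContMDiffOn ((𝓡 n).prod 𝓘(ℝ, ℝ)) (𝓡 n).tangent ∞
        (fun p : M × ℝ => (⟨p.1, X p⟩ : TangentBundle (𝓡 n) M)) (W ∩ univ ×ˢ J) ∧
      ∀ p ∈ W ∩ univ ×ˢ J, X p ≠ 0 ∧ L p.2 p.1 = Submodule.span ℝ {X p}

/-- A smooth Riemannian metric on `M`. -/
abbrev SmoothMetric (n : ℕ) (M : Type*) [TopologicalSpace M]
    [ChartedSpace (EuclideanSpace ℝ (Fin n)) M] [IsManifold (𝓡 n) ∞ M] : Type _ :=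
  ContMDiffRiemannianMetric (𝓡 n) ∞ (EuclideanSpace ℝ (Fin n))
    (fun x : M => TangentSpace (𝓡 n) x)

/-- `cov` is the Levi-Civita connection of `g`: it is torsion free and
`X g(Y, Z) = g(∇_X Y, Z) + g(Y, ∇_X Z)`. In Mathlib's notation `cov Y x (X x)` is `∇_X Y` at `x`.
(Such a connection exists and is unique on differentiable vector fields.) -/
def IsLeviCivita {n : ℕ} {M : Type*} [TopologicalSpace M]
    [ChartedSpace (EuclideanSpace ℝ (Fin n)) M] [IsManifold (𝓡 n) ∞ M]
    (g : SmoothMetric n M)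
    (cov : CovariantDerivative (𝓡 n) (EuclideanSpace ℝ (Fin n))
      (fun x : M => TangentSpace (𝓡 n) x)) : Prop :=
  cov.torsion = 0 ∧
  ∀ (x : M) (X Y Z : ∀ y : M, TangentSpace (𝓡 n) y),
    MDifferentiableAt (𝓡 n) (𝓡 n).tangent (fun y => (⟨y, X y⟩ : TangentBundle (𝓡 n) M)) x →
    MDifferentiableAt (𝓡 n) (𝓡 n).tangent (fun y => (⟨y, Y y⟩ : TangentBundle (𝓡 n) M)) x →
    MDifferentiableAt (𝓡 n) (𝓡 n).tangent (fun y => (⟨y, Z y⟩ : TangentBundle (𝓡 n) M)) x →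
    mvfderiv (𝓡 n) (fun y => g.inner y (Y y) (Z y)) x (X x) =
      g.inner x (cov Y x (X x)) (Z x) + g.inner x (Y x) (cov Z x (X x))

/-- Every leaf of the one-dimensional foliation `L` is a minimal submanifold of `(M, g)`. For a
unit vector field `T` tangent to the leaves, the mean curvature vector of the leaf through `x` is
the component of `∇_T T` normal to the leaf, and it has to vanish at every point `x`. -/
def LeavesAreMinimal {n : ℕ} {M : Type*} [TopologicalSpace M]
    [ChartedSpace (EuclideanSpace ℝ (Fin n)) M] [IsManifold (𝓡 n) ∞ M]
    (g : SmoothMetric n M) (L : TangentDistribution n M) : Prop :=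
  ∀ cov : CovariantDerivative (𝓡 n) (EuclideanSpace ℝ (Fin n))
      (fun x : M => TangentSpace (𝓡 n) x), IsLeviCivita g cov →
  ∀ (x : M) (U : Set M), IsOpen U → x ∈ U → ∀ T : ∀ y : M, TangentSpace (𝓡 n) y,
    ContMDiffOn (𝓡 n) (𝓡 n).tangent ∞ (fun y => (⟨y, T y⟩ : TangentBundle (𝓡 n) M)) U →
    (∀ y ∈ U, T y ∈ L y ∧ g.inner y (T y) (T y) = 1) →
    ∀ N : TangentSpace (𝓡 n) x, (∀ w ∈ L x, g.inner x N w = 0) →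
      g.inner x (cov T x (T x)) N = 0

/-- `(M, L)` is minimizable: `M` carries a smooth Riemannian metric for which every leaf is a
minimal submanifold. -/
def IsMinimizable {n : ℕ} {M : Type*} [TopologicalSpace M]
    [ChartedSpace (EuclideanSpace ℝ (Fin n)) M] [IsManifold (𝓡 n) ∞ M]
    (L : TangentDistribution n M) : Prop :=
  IsFoliationOne L ∧ ∃ g : SmoothMetric n M, LeavesAreMinimal g L

end General

/-! ### The three-sphere as a union of two solid tori -/

/-- The unit sphere of `ℝ⁴ = ℂ²`. -/
abbrev S3 : Type := Metric.sphere (0 : EuclideanSpace ℝ (Fin 4)) 1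

/-- The complex coordinates `z 0 = x₀ + i x₁` and `z 1 = x₂ + i x₃` on `ℝ⁴ = ℂ²`. -/
def zc (j : Fin 2) (x : EuclideanSpace ℝ (Fin 4)) : ℂ :=
  if j = 0 then ⟨x 0, x 1⟩ else ⟨x 2, x 3⟩

/-- The point of `ℝ⁴ = ℂ²` with complex coordinates `a` and `b`. -/
def ofC2 (a b : ℂ) : EuclideanSpace ℝ (Fin 4) := !₂[a.re, a.im, b.re, b.im]

/-- A tangent vector of the sphere as a vector of `ℝ⁴`. -/
def toR4 (x : S3) : TangentSpace (𝓡 3) x →L[ℝ] EuclideanSpace ℝ (Fin 4) :=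
  mvfderiv (𝓡 3) (fun y : S3 => (y : EuclideanSpace ℝ (Fin 4))) x

/-- The angular one-form `dθ_j`, where `θ_j = arg z_j`, off the circle `z_j = 0`. -/
def dTheta (j : Fin 2) (x : S3) (v : TangentSpace (𝓡 3) x) : ℝ :=
  (starRingEnd ℂ (zc j x) * zc j (toR4 x v)).im / ‖zc j x‖ ^ 2

/-- The line spanned by `∂/∂θ_j` (at points with `z_j ≠ 0`): the tangent line of the circle
`θ ↦ (…, e^{iθ} z_j, …)`, the other complex coordinate being fixed. -/
def thetaLine (j : Fin 2) : TangentDistribution 3 S3 := fun x =>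
  (Submodule.span ℝ {if j = 0 then ofC2 (Complex.I * zc 0 x) 0
    else ofC2 0 (Complex.I * zc 1 x)}).comap (toR4 x).toLinearMap

/-- The radius coordinate `ρ_i` around the axis `A_i = {z_i = 0}`, indices being modulo `2`. The map
`x ↦ (z_{i+1} / |z_{i+1}|, 2 z_i / |z_{i+1}|)` identifies the set `ρ_i ≤ r` with the standard solid
torus `S¹ × D²(r)`; in these coordinates `θ_{i+1}` is the longitude angle and `(ρ_i, θ_i)` are the
polar coordinates of the disc factor. -/
def rho (i : Fin 2) (x : S3) : ℝ := 2 * ‖zc i x‖ / ‖zc (i + 1) x‖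

/-- The closed solid torus of radius `r` around the axis `A_i`. The sphere is the union of
`solidTorus 0 2` and `solidTorus 1 2`, which meet along their common boundary torus
`|z 0| = |z 1|`; the meridian angle `θ_i` of one is the longitude angle of the other. -/
def solidTorus (i : Fin 2) (r : ℝ) : Set S3 := {x | 2 * ‖zc i x‖ ≤ r * ‖zc (i + 1) x‖}

/-! ### The foliation of Candel and Conlon -/

/-- The restriction of `L` to the solid torus of radius `2` around `A_i` is tangent to a
turbulization of the product foliation by discs along the axis: the axis is a leaf of `L`, the other
leaves of `L` lie on the trumpets `θ_{i+1} = c + f(ρ_i)`, where `|f(ρ)| → ∞` as `ρ → 0`, and `L` is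
transverse to the boundary torus. -/
def IsTurbulizedTorus (i : Fin 2) (L : TangentDistribution 3 S3) : Prop :=
  (∀ x : S3, zc i x = 0 → L x = thetaLine (i + 1) x) ∧
  (∃ f : ℝ → ℝ, ContDiffOn ℝ ∞ f (Ioi 0) ∧ Tendsto (fun r => |f r|) (𝓝[>] 0) atTop ∧
    ∀ x ∈ solidTorus i 2, zc i x ≠ 0 → ∀ v ∈ L x,
      dTheta (i + 1) x v = deriv f (rho i x) * mvfderiv (𝓡 3) (rho i) x v) ∧
  (∀ x : S3, ‖zc i x‖ = ‖zc (i + 1) x‖ → ∀ v ∈ L x, v ≠ 0 → mvfderiv (𝓡 3) (rho i) x v ≠ 0)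

/-- `L` is a Candel-Conlon foliation of the three-sphere: a smooth one-dimensional foliation
obtained by pasting two turbulized solid tori along their boundaries, meridians to longitudes, so
that off the two axes the leaves are transverse to `dθ_0 + dθ_1`. -/
structure IsCandelConlon (L : TangentDistribution 3 S3) : Prop where
  foliation : IsFoliationOne L
  turbulized : ∀ i : Fin 2, IsTurbulizedTorus i L
  transverse : ∀ x : S3, zc 0 x ≠ 0 → zc 1 x ≠ 0 → ∀ v ∈ L x, v ≠ 0 →
    dTheta 0 x v + dTheta 1 x v ≠ 0

/-! ### Replacing the two axes by product foliated solid tori of radius `t` -/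

theorem radial_mem_sphere (k : ℝ) {a b : ℂ} (ha : a ≠ 0) (hb : b ≠ 0) :
    ofC2 ((k / (Real.sqrt (1 + k ^ 2) * ‖a‖) : ℝ) * a)
      ((1 / (Real.sqrt (1 + k ^ 2) * ‖b‖) : ℝ) * b) ∈
        Metric.sphere (0 : EuclideanSpace ℝ (Fin 4)) 1 := by
  have h1 : Real.sqrt (1 + k ^ 2) ^ 2 = 1 + k ^ 2 := Real.sq_sqrt (by positivity)
  have h2 : (0 : ℝ) < Real.sqrt (1 + k ^ 2) := Real.sqrt_pos.2 (by positivity)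
  have h3 : 0 < ‖a‖ := norm_pos_iff.2 ha
  have h4 : 0 < ‖b‖ := norm_pos_iff.2 hb
  have h5 : ‖a‖ ^ 2 = a.re ^ 2 + a.im ^ 2 := by
    rw [Complex.sq_norm, Complex.normSq_apply]; ring
  have h6 : ‖b‖ ^ 2 = b.re ^ 2 + b.im ^ 2 := by
    rw [Complex.sq_norm, Complex.normSq_apply]; ring
  have key : (k / (Real.sqrt (1 + k ^ 2) * ‖a‖)) ^ 2 * (a.re ^ 2 + a.im ^ 2) +
      (1 / (Real.sqrt (1 + k ^ 2) * ‖b‖)) ^ 2 * (b.re ^ 2 + b.im ^ 2) = 1 := by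
    rw [← h5, ← h6, div_pow, div_pow, mul_pow, mul_pow, h1]
    have h7 : (0 : ℝ) < 1 + k ^ 2 := by positivity
    field_simp
    ring
  rw [mem_sphere_zero_iff_norm, EuclideanSpace.norm_eq, Real.sqrt_eq_one]
  simp only [ofC2, Fin.sum_univ_four, Real.norm_eq_abs, sq_abs, Complex.re_ofReal_mul,
    Complex.im_ofReal_mul]
  simp only [Matrix.cons_val]
  linear_combination key

/-- The map of the sphere minus the two axes that keeps the angles `θ_0`, `θ_1` and changes
`u = |z 0| / |z 1|` to `k u`. (On the axes it is set to be the identity.) -/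
def radialMap (k : ℝ → ℝ) (x : S3) : S3 :=
  if h : zc 0 x ≠ 0 ∧ zc 1 x ≠ 0 then ⟨_, radial_mem_sphere (k (‖zc 0 x‖ / ‖zc 1 x‖)) h.1 h.2⟩
  else x

/-- `k` is a smooth increasing diffeomorphism onto `(0, ∞)` of the interval of values that
`u = |z 0| / |z 1|` takes outside of the two solid tori of radius `t` around the axes. So
`radialMap k` is a diffeomorphism from the complement of these solid tori to the complement of the
axes. -/
def IsCollapse (t : ℝ) (k : ℝ → ℝ) : Prop :=
  ContDiffOn ℝ ∞ k {u | t < 2 * u ∧ t * u < 2} ∧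
  (∀ u ∈ {u : ℝ | t < 2 * u ∧ t * u < 2}, 0 < deriv k u) ∧
  BijOn k {u | t < 2 * u ∧ t * u < 2} (Ioi 0)

open Classical in
/-- The foliation obtained from `L` by replacing the axes `A_0`, `A_1` by the solid tori of radius
`t` around them: on `S¹ × D²(t)` it is the product foliation by the circles `S¹ × {q}`, and on the
complement it is the pull-back of `L` from the complement of the axes. -/
def insertTori (t : ℝ) (k : ℝ → ℝ) (L : TangentDistribution 3 S3) : TangentDistribution 3 S3 :=
  fun x =>
    if x ∈ solidTorus 0 t then thetaLine 1 x
    else if x ∈ solidTorus 1 t then thetaLine 0 x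
    else (L (radialMap k x)).comap (mfderiv (𝓡 3) (𝓡 3) (radialMap k) x).toLinearMap

end

/-! The proof is the Rummler–Sullivan criterion for curves: leaves are geodesics of some metric once
a one-form `η` is nonzero on nonzero tangent vectors `v` of the leaves and `dη(v, ·) = 0` for all of
them. Choose the metric so that `g(v, ·) = η(v) η` for `v` tangent to the leaves
(`exists_smoothMetric_dual`). A unit tangent field `T` then has `η(T) = ±1`, and Koszul-type
manipulations reduce `g(∇_T T, N)` to `dη(T, N) = 0` (`leavesAreMinimal_of_dual`, combined in
`isMinimizable_of_oneForm`).

For the foliation at hand take `η = h(|z₀|²)|z₀|² dθ₀ + h(|z₁|²)|z₁|² dθ₁`, where `h` is smooth and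
`h(s) = 1/s` except for small `s`. Outside both solid tori of radius `t` this is `dθ₀ + dθ₁`. It is
closed there, and it is nonzero on the leaves because the radial map is an immersion preserving
`dθ₀` and `dθ₁` (`dTheta_radialMap`, `eq_zero_of_mfderiv_radialMap`), so that transversality of the
original foliation is inherited.

In the torus around `A₀` the second term is still `dθ₁`, while the first involves only `z₀`. The
leaves there are the `θ₁`-circles, along which `z₀` is constant. Hence `η` is nonzero on them, and
contracting `dη` with their tangent vectors gives zero although `η` need not be closed. The other
torus is symmetric. The room for cutting off `1/s` is the positive radius `t`. -/

noncomputable section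

/-! ### Vector fields as derivations and the Lie bracket, read in charts. -/

section Manifolds

variable {n : ℕ} {M : Type*} [TopologicalSpace M]
  [ChartedSpace (EuclideanSpace ℝ (Fin n)) M] [IsManifold (𝓡 n) ∞ M]

open VectorField in
/-- In the chart around `x`, a vector field is read through the derivative of the chart. -/
theorem mpullbackWithin_extChartAt_symm_apply (x : M) (V : ∀ y : M, TangentSpace (𝓡 n) y)
    {y : M} (hy : y ∈ (extChartAt (𝓡 n) x).source) :
    mpullbackWithin 𝓘(ℝ, EuclideanSpace ℝ (Fin n)) (𝓡 n) (extChartAt (𝓡 n) x).symm V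
      (range (𝓡 n)) (extChartAt (𝓡 n) x y) = mfderiv (𝓡 n) 𝓘(ℝ, EuclideanSpace ℝ (Fin n))
        (extChartAt (𝓡 n) x) y (V y) := by
  have : IsManifold (𝓡 n) 1 M := .of_le (n := ∞) (by simp)
  have h1 := mfderivWithin_extChartAt_symm_comp_mfderiv_extChartAt' (I := 𝓡 n) hy
  have h2 := mfderiv_extChartAt_comp_mfderivWithin_extChartAt_symm' (I := 𝓡 n) hy
  have hV : ∀ z, z = y → (show EuclideanSpace ℝ (Fin n) from V z) = V y := by
    rintro _ rfl
    rfl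
  have heq := ContinuousLinearMap.inverse_eq h1 h2
  rw [mpullbackWithin_apply]
  exact (congrArg _ (hV _ (PartialEquiv.left_inv _ hy))).trans (DFunLike.congr_fun heq (V y))

/-- The derivative of a function along a vector field, in the chart around `x`. -/
theorem mvfderiv_eq_fderiv_extChartAt (x : M) {b : M → ℝ} {y : M}
    (hy : y ∈ (extChartAt (𝓡 n) x).source) (hb : MDifferentiableAt (𝓡 n) 𝓘(ℝ, ℝ) b y)
    (v : TangentSpace (𝓡 n) y) :
    mvfderiv (𝓡 n) b y v = fderiv ℝ (b ∘ (extChartAt (𝓡 n) x).symm) (extChartAt (𝓡 n) x y)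
      (mfderiv (𝓡 n) 𝓘(ℝ, EuclideanSpace ℝ (Fin n)) (extChartAt (𝓡 n) x) y v) := by
  have : IsManifold (𝓡 n) 1 M := .of_le (n := ∞) (by simp)
  have hφ : MDifferentiableAt (𝓡 n) 𝓘(ℝ, EuclideanSpace ℝ (Fin n)) (extChartAt (𝓡 n) x) y :=
    mdifferentiableAt_extChartAt (by simpa using hy)
  have hs : MDifferentiableAt 𝓘(ℝ, EuclideanSpace ℝ (Fin n)) (𝓡 n) (extChartAt (𝓡 n) x).symm
      (extChartAt (𝓡 n) x y) := by
    have := mdifferentiableWithinAt_extChartAt_symm (I := 𝓡 n) ((extChartAt (𝓡 n) x).map_source hy)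
    simpa [mdifferentiableWithinAt_univ] using this
  have hb' : MDifferentiableAt 𝓘(ℝ, EuclideanSpace ℝ (Fin n)) 𝓘(ℝ, ℝ)
      (b ∘ (extChartAt (𝓡 n) x).symm) (extChartAt (𝓡 n) x y) :=
    MDifferentiableAt.comp_of_eq _ hb hs (PartialEquiv.left_inv _ hy)
  have hcongr : b =ᶠ[𝓝 y] (b ∘ (extChartAt (𝓡 n) x).symm) ∘ extChartAt (𝓡 n) x := by
    filter_upwards [(isOpen_extChartAt_source (I := 𝓡 n) x).mem_nhds hy] with z hz
    simp only [Function.comp_apply]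
    rw [PartialEquiv.left_inv _ hz]
  have h1 : mvfderiv (𝓡 n) b y v = mfderiv (𝓡 n) 𝓘(ℝ, ℝ) b y v := rfl
  rw [h1, hcongr.mfderiv_eq, mfderiv_comp y hb' hφ, mfderiv_eq_fderiv]
  rfl

open VectorField in
/-- The Lie bracket acts on functions as the commutator of derivations. -/
theorem mvfderiv_mlieBracket {x : M} {b : M → ℝ} (hb : ContMDiff (𝓡 n) 𝓘(ℝ, ℝ) ∞ b)
    {V W : ∀ y : M, TangentSpace (𝓡 n) y}
    (hV : MDifferentiableAt (𝓡 n) (𝓡 n).tangent (fun y => (⟨y, V y⟩ : TangentBundle (𝓡 n) M)) x)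
    (hW : MDifferentiableAt (𝓡 n) (𝓡 n).tangent (fun y => (⟨y, W y⟩ : TangentBundle (𝓡 n) M)) x) :
    MDifferentiableAt (𝓡 n) 𝓘(ℝ, ℝ) (fun y => mvfderiv (𝓡 n) b y (V y)) x ∧
    mvfderiv (𝓡 n) b x (mlieBracket (𝓡 n) V W x) =
      mvfderiv (𝓡 n) (fun y => mvfderiv (𝓡 n) b y (W y)) x (V x) -
        mvfderiv (𝓡 n) (fun y => mvfderiv (𝓡 n) b y (V y)) x (W x) := by
  have : IsManifold (𝓡 n) 1 M := .of_le (n := ∞) (by simp)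
  have : IsManifold (𝓡 n) 2 M := .of_le (n := ∞) ENat.LEInfty.out
  set φ := extChartAt (𝓡 n) x with hφdef
  set β := b ∘ φ.symm with hβ
  have hx : x ∈ φ.source := mem_extChartAt_source x
  have hbd : ∀ y, MDifferentiableAt (𝓡 n) 𝓘(ℝ, ℝ) b y := fun y =>
    hb.mdifferentiableAt (by simp)
  have hβs : ContDiffAt ℝ 2 β (φ x) := by
    have h1 : ContMDiffAt 𝓘(ℝ, EuclideanSpace ℝ (Fin n)) 𝓘(ℝ, ℝ) ∞ β (φ x) := by
      refine ContMDiffAt.comp _ hb.contMDiffAt ?_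
      exact (contMDiffOn_extChartAt_symm x).contMDiffAt (extChartAt_target_mem_nhds x)
    exact h1.contDiffAt.of_le ENat.LEInfty.out
  have hfd : DifferentiableAt ℝ (fderiv ℝ β) (φ x) :=
    (hβs.fderiv_right (m := 1) (by norm_num)).differentiableAt (by norm_num)
  -- Chart expression `U'` of a field: differentiable at the base point, and differentiating `b`
  -- along `U` becomes `fderiv β` applied to `U'`.
  have read : ∀ U : ∀ y : M, TangentSpace (𝓡 n) y,
      MDifferentiableAt (𝓡 n) (𝓡 n).tangent (fun y => (⟨y, U y⟩ : TangentBundle (𝓡 n) M)) x →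
      ∃ U' : EuclideanSpace ℝ (Fin n) → EuclideanSpace ℝ (Fin n),
        U' = mpullbackWithin 𝓘(ℝ, EuclideanSpace ℝ (Fin n)) (𝓡 n) φ.symm U (range (𝓡 n)) ∧
        DifferentiableAt ℝ U' (φ x) ∧
        (∀ y ∈ φ.source, U' (φ y) = mfderiv (𝓡 n) 𝓘(ℝ, EuclideanSpace ℝ (Fin n)) φ y (U y)) ∧
        (fun y => mvfderiv (𝓡 n) b y (U y)) =ᶠ[𝓝 x]
          (fun z => fderiv ℝ β z (U' z)) ∘ φ := by
    intro U hU
    refine ⟨_, rfl, ?_, fun y hy => mpullbackWithin_extChartAt_symm_apply x U hy, ?_⟩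
    · have := MDifferentiableWithinAt.differentiableWithinAt_mpullbackWithin_vectorField
        (s := univ) (V := U) hU.mdifferentiableWithinAt
      have e : (φ.symm ⁻¹' univ ∩ range (𝓡 n)) = univ := by simp
      rw [e] at this
      exact differentiableWithinAt_univ.1 this
    · filter_upwards [(isOpen_extChartAt_source (I := 𝓡 n) x).mem_nhds hx] with y hy
      rw [Function.comp_apply, mvfderiv_eq_fderiv_extChartAt x hy (hbd y),
        mpullbackWithin_extChartAt_symm_apply x U hy]
  obtain ⟨V', hV', hV'd, hV'a, hVc⟩ := read V hV
  obtain ⟨W', hW', hW'd, hW'a, hWc⟩ := read W hW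
  have hφd : MDifferentiableAt (𝓡 n) 𝓘(ℝ, EuclideanSpace ℝ (Fin n)) φ x :=
    mdifferentiableAt_extChartAt (mem_chart_source _ x)
  have dd : ∀ U' : EuclideanSpace ℝ (Fin n) → EuclideanSpace ℝ (Fin n),
      DifferentiableAt ℝ U' (φ x) → HasFDerivAt (fun z => fderiv ℝ β z (U' z))
        ((fderiv ℝ β (φ x)).comp (fderiv ℝ U' (φ x)) +
          (fderiv ℝ (fderiv ℝ β) (φ x)).flip (U' (φ x))) (φ x) := fun U' hU' =>
    hfd.hasFDerivAt.clm_apply hU'.hasFDerivAt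
  have ddx : ∀ (f : M → ℝ) (U' : EuclideanSpace ℝ (Fin n) → EuclideanSpace ℝ (Fin n)),
      DifferentiableAt ℝ U' (φ x) → f =ᶠ[𝓝 x] (fun z => fderiv ℝ β z (U' z)) ∘ φ →
      MDifferentiableAt (𝓡 n) 𝓘(ℝ, ℝ) f x ∧ ∀ v : TangentSpace (𝓡 n) x,
      mvfderiv (𝓡 n) f x v = fderiv ℝ (fun z => fderiv ℝ β z (U' z)) (φ x)
        (mfderiv (𝓡 n) 𝓘(ℝ, EuclideanSpace ℝ (Fin n)) φ x v) := by
    intro f U' hU' hf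
    have hm : MDifferentiableAt 𝓘(ℝ, EuclideanSpace ℝ (Fin n)) 𝓘(ℝ, ℝ)
      (fun z => fderiv ℝ β z (U' z)) (φ x) := (dd U' hU').differentiableAt.mdifferentiableAt
    refine ⟨(hm.comp x hφd).congr_of_eventuallyEq hf, fun v => ?_⟩
    have h1 : mvfderiv (𝓡 n) f x v = mfderiv (𝓡 n) 𝓘(ℝ, ℝ) f x v := rfl
    rw [h1, hf.mfderiv_eq, mfderiv_comp x hm hφd, mfderiv_eq_fderiv]
    rfl
  refine ⟨(ddx _ V' hV'd hVc).1, ?_⟩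
  rw [(ddx _ V' hV'd hVc).2, (ddx _ W' hW'd hWc).2, ← hV'a x hx, ← hW'a x hx,
    (dd V' hV'd).fderiv, (dd W' hW'd).fderiv, mvfderiv_eq_fderiv_extChartAt x hx (hbd x)]
  -- Symmetry of the second derivative cancels the second-order terms of the commutator; the
  -- first-order terms are the coordinate bracket.
  have hsym : fderiv ℝ (fderiv ℝ β) (φ x) (V' (φ x)) (W' (φ x)) =
      fderiv ℝ (fderiv ℝ β) (φ x) (W' (φ x)) (V' (φ x)) :=
    (hβs.isSymmSndFDerivAt (by simp)).eq _ _
  have hbr : mfderiv (𝓡 n) 𝓘(ℝ, EuclideanSpace ℝ (Fin n)) φ x (mlieBracket (𝓡 n) V W x) =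
      fderiv ℝ W' (φ x) (V' (φ x)) - fderiv ℝ V' (φ x) (W' (φ x)) := by
    have hinv := isInvertible_mfderiv_extChartAt (I := 𝓡 n) hx
    have e : (φ.symm ⁻¹' univ ∩ range (𝓡 n)) = univ := by simp
    rw [← mlieBracketWithin_univ, mlieBracketWithin_apply, ← hφdef, ← hV', ← hW', e,
      lieBracketWithin_univ, lieBracket_eq]
    exact ContinuousLinearMap.IsInvertible.self_apply_inverse hinv _
  rw [hbr, map_sub]
  simp only [add_apply, ContinuousLinearMap.comp_apply,
    ContinuousLinearMap.flip_apply]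
  rw [hsym]
  ring

end Manifolds

/-! ### Smooth one-forms and their tensor products. -/

theorem ContMDiffAt.smulRight {E H M V W : Type*} [NormedAddCommGroup E] [NormedSpace ℝ E]
    [TopologicalSpace H] {I : ModelWithCorners ℝ E H} [TopologicalSpace M] [ChartedSpace H M]
    [NormedAddCommGroup V] [NormedSpace ℝ V] [NormedAddCommGroup W] [NormedSpace ℝ W]
    {f : M → V →L[ℝ] ℝ} {g : M → W} {x : M} {m : WithTop ℕ∞}
    (hf : ContMDiffAt I 𝓘(ℝ, V →L[ℝ] ℝ) m f x) (hg : ContMDiffAt I 𝓘(ℝ, W) m g x) :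
    ContMDiffAt I 𝓘(ℝ, V →L[ℝ] W) m (fun y => (f y).smulRight (g y)) x :=
  (ContDiff.smulRight (contDiff_fst (E := V →L[ℝ] ℝ) (F := W)) contDiff_snd).contMDiff.contMDiffAt.comp x
    (hf.prodMk_space hg)

section Manifolds

variable {n : ℕ} {M : Type*} [TopologicalSpace M]
  [ChartedSpace (EuclideanSpace ℝ (Fin n)) M] [IsManifold (𝓡 n) ∞ M]

/-- A smooth one-form, as a smooth section of the cotangent bundle. -/
def IsSmoothOneForm (α : ∀ x : M, TangentSpace (𝓡 n) x →L[ℝ] ℝ) : Prop :=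
  ContMDiff (𝓡 n) ((𝓡 n).prod 𝓘(ℝ, EuclideanSpace ℝ (Fin n) →L[ℝ] ℝ)) ∞
    (fun x => TotalSpace.mk' (EuclideanSpace ℝ (Fin n) →L[ℝ] ℝ)
      (E := fun x : M => TangentSpace (𝓡 n) x →L[ℝ] Trivial M ℝ x) x (α x))

theorem isSmoothOneForm_mvfderiv {f : M → ℝ} (hf : ContMDiff (𝓡 n) 𝓘(ℝ, ℝ) ∞ f) :
    IsSmoothOneForm (fun x => mvfderiv (𝓡 n) f x) := by
  intro x₀
  have : IsManifold (𝓡 n) 1 M := .of_le (n := ∞) (by simp)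
  rw [contMDiffAt_hom_bundle]
  refine ⟨contMDiffAt_id, ?_⟩
  refine ((hf x₀).mfderiv_const (m := ∞) (by simp)).congr_of_eventuallyEq ?_
  filter_upwards with x
  ext v
  simp [inTangentCoordinates, ContinuousLinearMap.inCoordinates, mvfderiv]
  rfl

theorem IsSmoothOneForm.smul {α : ∀ x : M, TangentSpace (𝓡 n) x →L[ℝ] ℝ} (hα : IsSmoothOneForm α)
    {c : M → ℝ} (hc : ContMDiff (𝓡 n) 𝓘(ℝ, ℝ) ∞ c) : IsSmoothOneForm (fun x => c x • α x) :=
  ContMDiff.smul_section hc hα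

theorem IsSmoothOneForm.sub {α β : ∀ x : M, TangentSpace (𝓡 n) x →L[ℝ] ℝ}
    (hα : IsSmoothOneForm α) (hβ : IsSmoothOneForm β) : IsSmoothOneForm (fun x => α x - β x) :=
  ContMDiff.sub_section hα hβ

theorem IsSmoothOneForm.sum {ι : Type*} {s : Finset ι}
    {α : ι → ∀ x : M, TangentSpace (𝓡 n) x →L[ℝ] ℝ}
    (hα : ∀ i, IsSmoothOneForm (α i)) : IsSmoothOneForm (fun x => ∑ i ∈ s, α i x) :=
  ContMDiff.sum_section (fun i _ => hα i)

theorem IsSmoothOneForm.contMDiff_smulRight {α β : ∀ x : M, TangentSpace (𝓡 n) x →L[ℝ] ℝ}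
    (hα : IsSmoothOneForm α) (hβ : IsSmoothOneForm β) :
    ContMDiff (𝓡 n) ((𝓡 n).prod 𝓘(ℝ, EuclideanSpace ℝ (Fin n) →L[ℝ] EuclideanSpace ℝ (Fin n) →L[ℝ] ℝ)) ∞
      (fun x => TotalSpace.mk' (EuclideanSpace ℝ (Fin n) →L[ℝ] EuclideanSpace ℝ (Fin n) →L[ℝ] ℝ)
      (E := fun x : M => TangentSpace (𝓡 n) x →L[ℝ] TangentSpace (𝓡 n) x →L[ℝ] Trivial M ℝ x)
      x ((α x).smulRight (β x))) := by
  intro x₀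
  have h1 := hα x₀
  have h2 := hβ x₀
  rw [contMDiffAt_hom_bundle] at h1 h2 ⊢
  refine ⟨contMDiffAt_id, ?_⟩
  have h3 := h1.2.smulRight h2.2
  refine h3.congr_of_eventuallyEq ?_
  have hb := (trivializationAt (EuclideanSpace ℝ (Fin n)) (TangentSpace (𝓡 n)) x₀).open_baseSet.mem_nhds
    (FiberBundle.mem_baseSet_trivializationAt' x₀)
  filter_upwards [hb] with x hx
  ext v w
  simp [ContinuousLinearMap.inCoordinates]
  left
  rw [Trivialization.linearMapAt_apply, if_pos (by simpa using hx), hom_trivializationAt_apply]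
  simp [ContinuousLinearMap.inCoordinates]

theorem IsSmoothOneForm.contMDiffOn_apply {α : ∀ x : M, TangentSpace (𝓡 n) x →L[ℝ] ℝ}
    (hα : IsSmoothOneForm α) {X : ∀ x : M, TangentSpace (𝓡 n) x} {U : Set M}
    (hX : ContMDiffOn (𝓡 n) (𝓡 n).tangent ∞ (fun x => (⟨x, X x⟩ : TangentBundle (𝓡 n) M)) U) :
    ContMDiffOn (𝓡 n) 𝓘(ℝ, ℝ) ∞ (fun x => α x (X x)) U := by
  have h := ContMDiffOn.clm_bundle_apply (F₁ := EuclideanSpace ℝ (Fin n)) (F₂ := ℝ)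
    (E₁ := fun x : M => TangentSpace (𝓡 n) x) (E₂ := Trivial M ℝ) (hα.contMDiffOn (s := U)) hX
  intro x hx
  have := h x hx
  rw [contMDiffWithinAt_totalSpace] at this
  exact this.2

end Manifolds

/-- By compactness `B` has a positive minimum `m` on the unit sphere, so `m ‖v‖² ≤ B v v`. This is
the boundedness of unit balls that is part of the definition of a Riemannian metric. -/
theorem isVonNBounded_of_pos {E : Type*} [NormedAddCommGroup E] [NormedSpace ℝ E]
    [FiniteDimensional ℝ E] (B : E →L[ℝ] E →L[ℝ] ℝ) (hB : ∀ v, v ≠ 0 → 0 < B v v) :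
    Bornology.IsVonNBounded ℝ {v : E | B v v < 1} := by
  rw [NormedSpace.isVonNBounded_iff]
  rcases (Metric.sphere (0 : E) 1).eq_empty_or_nonempty with h | h
  · have hz : ∀ v : E, v = 0 := by
      intro v
      by_contra hv
      have : ‖v‖⁻¹ • v ∈ Metric.sphere (0 : E) 1 := by
        simp [norm_smul, norm_ne_zero_iff.2 hv]
      simp [h] at this
    exact (Bornology.isBounded_singleton (x := (0 : E))).subset fun v _ => hz v
  · have hc : Continuous fun v : E => B v v := by fun_prop
    obtain ⟨u, hu, hmin⟩ := (isCompact_sphere (0 : E) 1).exists_isMinOn h hc.continuousOn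
    have hu0 : u ≠ 0 := by
      rintro rfl
      simp at hu
    have hm := hB u hu0
    set m := B u u with hmdef
    refine (Metric.isBounded_closedBall (x := (0 : E)) (r := (Real.sqrt m)⁻¹)).subset fun v hv => ?_
    rw [mem_closedBall_zero_iff]
    by_cases hv0 : v = 0
    · simp [hv0]
    have hvn : 0 < ‖v‖ := norm_pos_iff.2 hv0
    have h1 : ‖v‖⁻¹ • v ∈ Metric.sphere (0 : E) 1 := by
      simp [norm_smul, hvn.ne']
    have h2 : m ≤ ‖v‖⁻¹ * (‖v‖⁻¹ * B v v) := by simpa using hmin h1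
    have h3 : B v v < 1 := hv
    have h4 : m * ‖v‖ ^ 2 ≤ 1 := by
      calc m * ‖v‖ ^ 2 ≤ ‖v‖⁻¹ * (‖v‖⁻¹ * B v v) * ‖v‖ ^ 2 := by gcongr
        _ = B v v := by field_simp
        _ ≤ 1 := h3.le
    have hs : 0 < Real.sqrt m := Real.sqrt_pos.2 hm
    rw [← one_div, le_div_iff₀ hs]
    have h5 : (‖v‖ * Real.sqrt m) ^ 2 ≤ 1 := by
      rw [mul_pow, Real.sq_sqrt hm.le, mul_comm]
      exact h4
    nlinarith [mul_pos hvn hs]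

section Calculus

variable {n : ℕ} {M : Type*} [TopologicalSpace M] [ChartedSpace (EuclideanSpace ℝ (Fin n)) M]

theorem Filter.EventuallyEq.mvfderiv_eq {f f' : M → ℝ} {x : M} (h : f =ᶠ[𝓝 x] f') :
    mvfderiv (𝓡 n) f x = mvfderiv (𝓡 n) f' x := by
  ext v
  exact DFunLike.congr_fun h.mfderiv_eq v

theorem mvfderiv_mul_apply {f f' : M → ℝ} {x : M} (hf : MDifferentiableAt (𝓡 n) 𝓘(ℝ, ℝ) f x)
    (hf' : MDifferentiableAt (𝓡 n) 𝓘(ℝ, ℝ) f' x) (v : TangentSpace (𝓡 n) x) :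
    mvfderiv (𝓡 n) (fun y => f y * f' y) x v =
      f x * mvfderiv (𝓡 n) f' x v + f' x * mvfderiv (𝓡 n) f x v := by
  rw [mvfderiv_fun_mul hf hf']
  simp

theorem mvfderiv_sum_apply {ι : Type*} (s : Finset ι) {f : ι → M → ℝ} {x : M}
    (hf : ∀ i, MDifferentiableAt (𝓡 n) 𝓘(ℝ, ℝ) (f i) x) (v : TangentSpace (𝓡 n) x) :
    MDifferentiableAt (𝓡 n) 𝓘(ℝ, ℝ) (fun y => ∑ i ∈ s, f i y) x ∧
      mvfderiv (𝓡 n) (fun y => ∑ i ∈ s, f i y) x v = ∑ i ∈ s, mvfderiv (𝓡 n) (f i) x v := by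
  classical
  induction s using Finset.induction_on with
  | empty =>
    simp only [Finset.sum_empty]
    exact ⟨mdifferentiableAt_const, by rw [mvfderiv_const]; rfl⟩
  | insert i s hi ih =>
    simp only [Finset.sum_insert hi]
    refine ⟨(hf i).add ih.1, ?_⟩
    rw [mvfderiv_fun_add (hf i) ih.1, add_apply, ih.2]

end Calculus

/-! ### Metrics built from one-forms, and the criterion for geodesic leaves. -/

section Manifolds

variable {n : ℕ} {M : Type*} [TopologicalSpace M]
  [ChartedSpace (EuclideanSpace ℝ (Fin n)) M] [IsManifold (𝓡 n) ∞ M]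

set_option synthInstance.maxHeartbeats 200000 in
/-- Finitely many smooth one-forms without common kernel define a smooth metric: the sum of their
squares. -/
theorem exists_smoothMetric_of_oneForms {κ : Type*} [Fintype κ]
    (α : κ → ∀ x : M, TangentSpace (𝓡 n) x →L[ℝ] ℝ) (hα : ∀ j, IsSmoothOneForm (α j))
    (hinj : ∀ x v, (∀ j, α j x v = 0) → v = 0) :
    ∃ g : SmoothMetric n M, ∀ x v w, g.inner x v w = ∑ j, α j x v * α j x w := by
  have happ : ∀ (x : M) (v w : TangentSpace (𝓡 n) x),
      (∑ j, (α j x).smulRight (α j x)) v w = ∑ j, α j x v * α j x w := by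
    intro x v w
    simp
  have hpos : ∀ (x : M) (v : TangentSpace (𝓡 n) x), v ≠ 0 →
      0 < (∑ j, (α j x).smulRight (α j x)) v v := by
    intro x v hv
    rw [happ]
    by_contra hneg
    refine hv (hinj x v fun j => ?_)
    have h0 : ∑ j, α j x v * α j x v = 0 :=
      le_antisymm (not_lt.1 hneg) (Finset.sum_nonneg fun j _ => mul_self_nonneg _)
    have := (Finset.sum_eq_zero_iff_of_nonneg fun j _ => mul_self_nonneg (α j x v)).1 h0 j
      (Finset.mem_univ j)
    exact mul_self_eq_zero.1 this
  refine ⟨⟨fun x => ∑ j, (α j x).smulRight (α j x), ?_, hpos, ?_, ?_⟩, happ⟩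
  · intro x v w
    rw [happ, happ]
    exact Finset.sum_congr rfl fun j _ => mul_comm _ _
  · intro x
    exact isVonNBounded_of_pos (E := EuclideanSpace ℝ (Fin n))
      (∑ j, (α j x).smulRight (α j x)) (hpos x)
  · exact ContMDiff.sum_section (fun j _ => (hα j).contMDiff_smulRight (hα j))

/-- A foliation by curves on which a smooth one-form `η` does not vanish has a metric for which the
unit tangent vectors of the leaves are dual to `± η`. -/
theorem exists_smoothMetric_dual {κ : Type*} [Fintype κ] {L : TangentDistribution n M}
    (hL : IsFoliationOne L) {e : κ → M → ℝ} (he : ∀ j, ContMDiff (𝓡 n) 𝓘(ℝ, ℝ) ∞ (e j))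
    (hinj : ∀ x v, (∀ j, mvfderiv (𝓡 n) (e j) x v = 0) → v = 0)
    {η : ∀ x : M, TangentSpace (𝓡 n) x →L[ℝ] ℝ} (hη : IsSmoothOneForm η)
    (hne : ∀ x, ∀ v ∈ L x, v ≠ 0 → η x v ≠ 0) :
    ∃ g : SmoothMetric n M, ∀ x, ∀ v ∈ L x, ∀ w, g.inner x v w = η x v * η x w := by
  have hX : ∀ x, ∃ X ∈ L x, η x X = 1 := by
    intro x
    obtain ⟨U, -, hxU, X, -, hX⟩ := hL x
    obtain ⟨h0, hs⟩ := hX x hxU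
    have hm : X x ∈ L x := hs ▸ Submodule.mem_span_singleton_self _
    exact ⟨(η x (X x))⁻¹ • X x, (L x).smul_mem _ hm, by simp [hne x _ hm h0]⟩
  choose X hXL hXη using hX
  have hspan : ∀ x, ∀ v ∈ L x, v = η x v • X x := by
    intro x v hv
    by_contra hcon
    refine hne x (v - η x v • X x) ((L x).sub_mem hv ((L x).smul_mem _ (hXL x)))
      (sub_ne_zero.2 hcon) ?_
    simp [hXη]
  -- The field `X` with `η(X) = 1` was chosen pointwise. Against a smooth local spanning field `Y`
  -- one has `X = Y / η(Y)`, which gives smoothness of `de_j(X)`.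
  have hc : ∀ j, ContMDiff (𝓡 n) 𝓘(ℝ, ℝ) ∞ fun x => mvfderiv (𝓡 n) (e j) x (X x) := by
    intro j x₀
    obtain ⟨U, hU, hxU, Y, hY, hYL⟩ := hL x₀
    have hYm : ∀ x ∈ U, Y x ∈ L x := fun x hx => by
      rw [(hYL x hx).2]
      exact Submodule.mem_span_singleton_self _
    have h1 := (isSmoothOneForm_mvfderiv (he j)).contMDiffOn_apply hY
    have h2 := hη.contMDiffOn_apply hY
    have h3 := h1.div₀ h2 fun x hx => hne x _ (hYm x hx) (hYL x hx).1
    refine (h3.contMDiffAt (hU.mem_nhds hxU)).congr_of_eventuallyEq ?_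
    filter_upwards [hU.mem_nhds hxU] with x hx
    have hy := hne x _ (hYm x hx) (hYL x hx).1
    rw [Pi.div_apply, eq_div_iff hy]
    conv_rhs => rw [hspan x _ (hYm x hx)]
    rw [map_smul, smul_eq_mul, mul_comm]
  -- The forms `de_j - de_j(X) η` vanish on `L`, so only `η ⊗ η` contributes to `g(v, ·)` for `v` in
  -- `L`. Together with `η` they still have no common kernel.
  let α : Option κ → ∀ x : M, TangentSpace (𝓡 n) x →L[ℝ] ℝ := fun o => match o with
    | none => η
    | some j => fun x => mvfderiv (𝓡 n) (e j) x - mvfderiv (𝓡 n) (e j) x (X x) • η x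
  obtain ⟨g, hg⟩ := exists_smoothMetric_of_oneForms α
    (by
      rintro (_ | j)
      · exact hη
      · exact (isSmoothOneForm_mvfderiv (he j)).sub (hη.smul (hc j)))
    (by
      intro x v hv
      have h0 : η x v = 0 := hv none
      refine hinj x v fun j => ?_
      have := hv (some j)
      simpa [α, h0] using this)
  refine ⟨g, fun x v hv w => ?_⟩
  rw [hg, Fintype.sum_option]
  have : ∀ j, α (some j) x v = 0 := by
    intro j
    have h : α (some j) x v = mvfderiv (𝓡 n) (e j) x v - mvfderiv (𝓡 n) (e j) x (X x) * η x v := rfl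
    rw [h]
    conv_lhs => enter [1]; rw [hspan x v hv]
    rw [map_smul, smul_eq_mul]
    ring
  simp only [this, zero_mul, Finset.sum_const_zero, add_zero]
  rfl

/-- If `g(v, ·) = η(v) η` for the vectors `v` tangent to `L`, where `η = ∑ aᵢ dbᵢ` and `dη`
vanishes on the tangent vectors of `L`, then the leaves of `L` are geodesics of `g`. -/
theorem leavesAreMinimal_of_dual {ι : Type*} [Fintype ι] {L : TangentDistribution n M}
    {a b : ι → M → ℝ} (ha : ∀ i, ContMDiff (𝓡 n) 𝓘(ℝ, ℝ) ∞ (a i))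
    (hb : ∀ i, ContMDiff (𝓡 n) 𝓘(ℝ, ℝ) ∞ (b i)) {η : ∀ x : M, TangentSpace (𝓡 n) x →L[ℝ] ℝ}
    (hη : ∀ x v, η x v = ∑ i, a i x * mvfderiv (𝓡 n) (b i) x v)
    (hd : ∀ x, ∀ v ∈ L x, ∀ w, ∑ i, (mvfderiv (𝓡 n) (a i) x v * mvfderiv (𝓡 n) (b i) x w -
      mvfderiv (𝓡 n) (a i) x w * mvfderiv (𝓡 n) (b i) x v) = 0)
    (g : SmoothMetric n M) (hg : ∀ x, ∀ v ∈ L x, ∀ w, g.inner x v w = η x v * η x w) :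
    LeavesAreMinimal g L := by
  intro cov hcov x U hU hxU T hT hTL N₀ hN₀
  have : IsManifold (𝓡 n) 1 M := .of_le (n := ∞) (by simp)
  have : IsManifold (𝓡 n) 2 M := .of_le (n := ∞) ENat.LEInfty.out
  obtain ⟨htor, hmet⟩ := hcov
  rw [CovariantDerivative.torsion_eq_zero_iff] at htor
  -- The normal vector is extended to a field so that brackets and derivatives along it make sense.
  obtain ⟨N, hNx, hN⟩ : ∃ N : ∀ y : M, TangentSpace (𝓡 n) y, N x = N₀ ∧
      MDifferentiableAt (𝓡 n) (𝓡 n).tangent (fun y => (⟨y, N y⟩ : TangentBundle (𝓡 n) M)) x :=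
    ⟨FiberBundle.extend (EuclideanSpace ℝ (Fin n)) N₀, by simp,
      FiberBundle.mdifferentiableAt_extend ..⟩
  subst hNx
  have hUx := hU.mem_nhds hxU
  have hTd : MDifferentiableAt (𝓡 n) (𝓡 n).tangent
      (fun y => (⟨y, T y⟩ : TangentBundle (𝓡 n) M)) x :=
    (hT.contMDiffAt hUx).mdifferentiableAt (by simp)
  have hTT : ∀ y ∈ U, η y (T y) * η y (T y) = 1 := fun y hy => by
    rw [← hg y _ (hTL y hy).1]
    exact (hTL y hy).2
  have hηN : η x (N x) = 0 := by
    have h := hN₀ (T x) (hTL x hxU).1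
    rw [g.symm, hg x _ (hTL x hxU).1] at h
    exact (mul_eq_zero.1 h).resolve_left (left_ne_zero_of_mul_eq_one (hTT x hxU))
  -- derivatives of `η` along vector fields
  have had : ∀ i, MDifferentiableAt (𝓡 n) 𝓘(ℝ, ℝ) (a i) x := fun i =>
    (ha i).mdifferentiableAt (by simp)
  have hηd : ∀ V : ∀ y : M, TangentSpace (𝓡 n) y,
      MDifferentiableAt (𝓡 n) (𝓡 n).tangent (fun y => (⟨y, V y⟩ : TangentBundle (𝓡 n) M)) x →
      MDifferentiableAt (𝓡 n) 𝓘(ℝ, ℝ) (fun y => η y (V y)) x ∧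
      ∀ w, mvfderiv (𝓡 n) (fun y => η y (V y)) x w =
        ∑ i, (a i x * mvfderiv (𝓡 n) (fun y => mvfderiv (𝓡 n) (b i) y (V y)) x w +
          mvfderiv (𝓡 n) (b i) x (V x) * mvfderiv (𝓡 n) (a i) x w) := by
    intro V hV
    -- The bracket lemma is applied to the pair `V`, `V` only for its differentiability conclusion.
    have hf := fun i => (mvfderiv_mlieBracket (hb i) hV hV).1
    have hs := fun w => mvfderiv_sum_apply Finset.univ (fun i => (had i).mul (hf i)) w
    simp only [hη]
    refine ⟨(hs 0).1, fun w => ((hs w).2).trans ?_⟩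
    exact Finset.sum_congr rfl fun i _ => mvfderiv_mul_apply (had i) (hf i) w
  -- `η(T)² = 1` near `x`, so differentiating along `N` gives `2 η(T) N(η(T)) = 0`.
  have hsgn : mvfderiv (𝓡 n) (fun y => η y (T y)) x (N x) = 0 := by
    have hT1 : mvfderiv (𝓡 n) (fun y => η y (T y) * η y (T y)) x (N x) = 0 := by
      have : (fun y => η y (T y) * η y (T y)) =ᶠ[𝓝 x] fun _ => (1 : ℝ) := by
        filter_upwards [hUx] with y hy using hTT y hy
      rw [this.mvfderiv_eq, mvfderiv_const]
      rfl
    rw [mvfderiv_mul_apply (hηd T hTd).1 (hηd T hTd).1, ← two_mul] at hT1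
    have hne := left_ne_zero_of_mul_eq_one (hTT x hxU)
    simpa [hne] using hT1
  have h1 := hmet x N T T hN hTd hTd
  have h2 := hmet x T T N hTd hTd hN
  have h3 : mvfderiv (𝓡 n) (fun y => g.inner y (T y) (T y)) x (N x) = 0 := by
    have : (fun y => g.inner y (T y) (T y)) =ᶠ[𝓝 x] fun _ => (1 : ℝ) := by
      filter_upwards [hUx] with y hy using (hTL y hy).2
    rw [this.mvfderiv_eq, mvfderiv_const]
    rfl
  have h4 : mvfderiv (𝓡 n) (fun y => g.inner y (T y) (N y)) x (T x) =
      η x (T x) * mvfderiv (𝓡 n) (fun y => η y (N y)) x (T x) := by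
    have : (fun y => g.inner y (T y) (N y)) =ᶠ[𝓝 x] fun y => η y (T y) * η y (N y) := by
      filter_upwards [hUx] with y hy using hg y _ (hTL y hy).1 _
    rw [this.mvfderiv_eq, mvfderiv_mul_apply (hηd T hTd).1 (hηd N hN).1, hηN, zero_mul, add_zero]
  have h5 := htor hTd hN
  -- Zero torsion: `∇_T N = ∇_N T + [T, N]`.
  have h6 : g.inner x (T x) (cov N x (T x)) =
      g.inner x (T x) (cov T x (N x)) +
        η x (T x) * η x (VectorField.mlieBracket (𝓡 n) T N x) := by
    rw [← hg x _ (hTL x hxU).1, ← h5, map_sub]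
    ring
  -- Cartan's formula `dη(T, N) = T(η(N)) - N(η(T)) - η([T, N])`, in which the left side and the
  -- middle term vanish.
  have h7 : mvfderiv (𝓡 n) (fun y => η y (N y)) x (T x) =
      η x (VectorField.mlieBracket (𝓡 n) T N x) := by
    have hz := hd x (T x) (hTL x hxU).1 (N x)
    rw [(hηd T hTd).2] at hsgn
    rw [(hηd N hN).2, hη]
    simp only [fun i => (mvfderiv_mlieBracket (hb i) hTd hN).2]
    rw [← sub_eq_zero, ← Finset.sum_sub_distrib, ← hz, ← sub_eq_zero, ← Finset.sum_sub_distrib,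
      ← hsgn]
    exact Finset.sum_congr rfl fun i _ => by ring
  -- Now `h1` says `g(∇_N T, T) = 0`. In `h2` the bracket terms on the two sides cancel, leaving
  -- `g(∇_T T, N) = 0`.
  rw [h3, g.symm x (cov T x (N x)) (T x)] at h1
  rw [h4, h6, h7] at h2
  linarith

/-- The Rummler–Sullivan criterion with `η = ∑ aᵢ dbᵢ`, so that `dη = ∑ daᵢ ∧ dbᵢ` is expressed by
derivatives of functions alone. The `e j` play the part of an immersion and only serve to complete
`η ⊗ η` to a metric. -/
theorem isMinimizable_of_oneForm {ι κ : Type*} [Fintype ι] [Fintype κ] {L : TangentDistribution n M}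
    (hL : IsFoliationOne L) {e : κ → M → ℝ} (he : ∀ j, ContMDiff (𝓡 n) 𝓘(ℝ, ℝ) ∞ (e j))
    (hinj : ∀ x v, (∀ j, mvfderiv (𝓡 n) (e j) x v = 0) → v = 0)
    {a b : ι → M → ℝ} (ha : ∀ i, ContMDiff (𝓡 n) 𝓘(ℝ, ℝ) ∞ (a i))
    (hb : ∀ i, ContMDiff (𝓡 n) 𝓘(ℝ, ℝ) ∞ (b i))
    (hne : ∀ x, ∀ v ∈ L x, v ≠ 0 → ∑ i, a i x * mvfderiv (𝓡 n) (b i) x v ≠ 0)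
    (hd : ∀ x, ∀ v ∈ L x, ∀ w, ∑ i, (mvfderiv (𝓡 n) (a i) x v * mvfderiv (𝓡 n) (b i) x w -
      mvfderiv (𝓡 n) (a i) x w * mvfderiv (𝓡 n) (b i) x v) = 0) :
    IsMinimizable L := by
  have happ : ∀ (x : M) (v : TangentSpace (𝓡 n) x),
      (∑ i, a i x • mvfderiv (𝓡 n) (b i) x) v = ∑ i, a i x * mvfderiv (𝓡 n) (b i) x v := by
    intro x v
    simp
  obtain ⟨g, hg⟩ := exists_smoothMetric_dual hL he hinj
    (η := fun x => ∑ i, a i x • mvfderiv (𝓡 n) (b i) x)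
    (IsSmoothOneForm.sum fun i => (isSmoothOneForm_mvfderiv (hb i)).smul (ha i))
    (fun x v hv h0 => by rw [happ]; exact hne x v hv h0)
  exact ⟨hL, g, leavesAreMinimal_of_dual ha hb happ hd g hg⟩

end Manifolds

/-! ### Rotation forms in a plane and the cut-off of `1/s`. -/

section Manifolds

variable {n : ℕ} {M : Type*} [TopologicalSpace M]
  [ChartedSpace (EuclideanSpace ℝ (Fin n)) M]

theorem mvfderiv_real_comp {h : ℝ → ℝ} {s : M → ℝ} {x : M} (hh : DifferentiableAt ℝ h (s x))
    (hs : MDifferentiableAt (𝓡 n) 𝓘(ℝ, ℝ) s x) (v : TangentSpace (𝓡 n) x) :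
    MDifferentiableAt (𝓡 n) 𝓘(ℝ, ℝ) (fun y => h (s y)) x ∧
    mvfderiv (𝓡 n) (fun y => h (s y)) x v = deriv h (s x) * mvfderiv (𝓡 n) s x v := by
  have h1 : MDifferentiableAt 𝓘(ℝ, ℝ) 𝓘(ℝ, ℝ) h (s x) := hh.mdifferentiableAt
  refine ⟨h1.comp x hs, ?_⟩
  have h2 : mvfderiv (𝓡 n) (fun y => h (s y)) x v = mfderiv (𝓡 n) 𝓘(ℝ, ℝ) (h ∘ s) x v := rfl
  rw [h2, mfderiv_comp x h1 hs, mfderiv_eq_fderiv]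
  have h3 : (fderiv ℝ h (s x) ∘SL (mfderiv (𝓡 n) 𝓘(ℝ, ℝ) s x)) v =
    fderiv ℝ h (s x) (mvfderiv (𝓡 n) s x v) := rfl
  refine h3.trans ?_
  rw [fderiv_eq_smul_deriv, smul_eq_mul, mul_comm]

/-- The form `h(s) (f df' - f' df)`, `s = f² + f'²`, is closed where `s h(s)` is locally constant. -/
theorem angularForm_closed {h : ℝ → ℝ} {f f' : M → ℝ} {x : M}
    (hf : MDifferentiableAt (𝓡 n) 𝓘(ℝ, ℝ) f x) (hf' : MDifferentiableAt (𝓡 n) 𝓘(ℝ, ℝ) f' x)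
    (hh : DifferentiableAt ℝ h (f x * f x + f' x * f' x)) (v w : TangentSpace (𝓡 n) x)
    (hc : h (f x * f x + f' x * f' x) +
        (f x * f x + f' x * f' x) * deriv h (f x * f x + f' x * f' x) = 0 ∨
      (mvfderiv (𝓡 n) f x v = 0 ∧ mvfderiv (𝓡 n) f' x v = 0)) :
    (mvfderiv (𝓡 n) (fun y => -(h (f y * f y + f' y * f' y) * f' y)) x v * mvfderiv (𝓡 n) f x w -
      mvfderiv (𝓡 n) (fun y => -(h (f y * f y + f' y * f' y) * f' y)) x w * mvfderiv (𝓡 n) f x v) +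
    (mvfderiv (𝓡 n) (fun y => h (f y * f y + f' y * f' y) * f y) x v * mvfderiv (𝓡 n) f' x w -
      mvfderiv (𝓡 n) (fun y => h (f y * f y + f' y * f' y) * f y) x w * mvfderiv (𝓡 n) f' x v)
      = 0 := by
  have hs : MDifferentiableAt (𝓡 n) 𝓘(ℝ, ℝ) (fun y => f y * f y + f' y * f' y) x :=
    (hf.mul hf).add (hf'.mul hf')
  have ds : ∀ u, mvfderiv (𝓡 n) (fun y => f y * f y + f' y * f' y) x u =
      2 * (f x * mvfderiv (𝓡 n) f x u + f' x * mvfderiv (𝓡 n) f' x u) := by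
    intro u
    have e1 := mvfderiv_mul_apply hf hf u
    have e2 := mvfderiv_mul_apply hf' hf' u
    refine (DFunLike.congr_fun (mvfderiv_fun_add (hf.mul hf) (hf'.mul hf')) u).trans ?_
    refine (congrArg₂ (· + ·) e1 e2).trans ?_
    ring
  have dh := fun u => mvfderiv_real_comp (s := fun y => f y * f y + f' y * f' y) hh hs u
  have hH := (dh 0).1
  have d1 : ∀ u, mvfderiv (𝓡 n) (fun y => -(h (f y * f y + f' y * f' y) * f' y)) x u =
      -(h (f x * f x + f' x * f' x) * mvfderiv (𝓡 n) f' x u + f' x *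
        (deriv h (f x * f x + f' x * f' x) *
          (2 * (f x * mvfderiv (𝓡 n) f x u + f' x * mvfderiv (𝓡 n) f' x u)))) := by
    intro u
    rw [mvfderiv_fun_neg, neg_apply, mvfderiv_mul_apply hH hf', (dh u).2, ds]
  have d2 : ∀ u, mvfderiv (𝓡 n) (fun y => h (f y * f y + f' y * f' y) * f y) x u =
      h (f x * f x + f' x * f' x) * mvfderiv (𝓡 n) f x u + f x *
        (deriv h (f x * f x + f' x * f' x) *
          (2 * (f x * mvfderiv (𝓡 n) f x u + f' x * mvfderiv (𝓡 n) f' x u))) := by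
    intro u
    rw [mvfderiv_mul_apply hH hf, (dh u).2, ds]
  rw [d1, d1, d2, d2]
  -- The exterior derivative is `2 (h + s h') df ∧ df'`. It vanishes if the coefficient does, and
  -- its contraction with `v` vanishes if `v` is killed by `df` and `df'`.
  rcases hc with hc | ⟨h0, h1⟩
  · linear_combination (2 * (mvfderiv (𝓡 n) f x v * mvfderiv (𝓡 n) f' x w -
      mvfderiv (𝓡 n) f' x v * mvfderiv (𝓡 n) f x w)) * hc
  · rw [h0, h1]
    ring

end Manifolds

/-- A smooth function on the line that agrees with `s⁻¹` for `s > c / 2`. -/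
theorem exists_contDiff_eq_inv {c : ℝ} (hc : 0 < c) :
    ∃ h : ℝ → ℝ, ContDiff ℝ ∞ h ∧ ∀ s, c / 2 < s → h s = s⁻¹ := by
  -- The cut-off factor is `0` for `s ≤ c/4` and `1` for `s ≥ c/2`, so the singularity of `s⁻¹` at
  -- `0` is removed.
  refine ⟨fun s => Real.smoothTransition (4 * s / c - 1) * s⁻¹, ?_, fun s hs => ?_⟩
  · rw [contDiff_iff_contDiffAt]
    intro s
    by_cases hs : s = 0
    · subst hs
      refine (contDiffAt_const (c := (0 : ℝ))).congr_of_eventuallyEq ?_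
      filter_upwards [gt_mem_nhds (show (0 : ℝ) < c / 4 by positivity)] with s hs
      rw [Real.smoothTransition.zero_of_nonpos, zero_mul]
      rw [sub_nonpos, div_le_one hc]
      linarith
    · refine ContDiffAt.mul ?_ (contDiffAt_inv ℝ hs)
      exact Real.smoothTransition.contDiffAt.comp s (by fun_prop)
  · simp only
    rw [Real.smoothTransition.one_of_one_le, one_mul]
    rw [le_sub_iff_add_le, le_div_iff₀ hc]
    linarith

/-- The left side is the derivative of `s h(s)`, which is constantly `1` near `s`. -/
theorem add_mul_deriv_eq_zero_of_eq_inv {h : ℝ → ℝ} {c s : ℝ} (hc : 0 < c)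
    (hh : ∀ s, c / 2 < s → h s = s⁻¹) (hs : c < s) : h s + s * deriv h s = 0 := by
  have hs0 : s ≠ 0 := by linarith
  have : h =ᶠ[𝓝 s] fun s => s⁻¹ := by
    filter_upwards [lt_mem_nhds (show c / 2 < s by linarith)] with r hr using hh r hr
  rw [this.deriv_eq, this.eq_of_nhds, deriv_inv]
  field_simp
  ring

/-! ### Coordinates of the three-sphere -/

instance : Fact (Module.finrank ℝ (EuclideanSpace ℝ (Fin 4)) = 3 + 1) :=
  ⟨finrank_euclideanSpace_fin⟩

/-- The real coordinates on the sphere. -/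
def crd (i : Fin 4) (x : S3) : ℝ := (x : EuclideanSpace ℝ (Fin 4)) i

theorem contMDiff_coe_S3 : ContMDiff (𝓡 3) 𝓘(ℝ, EuclideanSpace ℝ (Fin 4)) ∞
    (fun y : S3 => (y : EuclideanSpace ℝ (Fin 4))) := contMDiff_coe_sphere

theorem contMDiff_crd (i : Fin 4) : ContMDiff (𝓡 3) 𝓘(ℝ, ℝ) ∞ (crd i) :=
  (EuclideanSpace.proj (𝕜 := ℝ) i).contDiff.contMDiff.comp contMDiff_coe_S3

theorem mdifferentiableAt_crd (i : Fin 4) (x : S3) : MDifferentiableAt (𝓡 3) 𝓘(ℝ, ℝ) (crd i) x :=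
  (contMDiff_crd i).mdifferentiableAt (by simp)

theorem mvfderiv_crd (i : Fin 4) (x : S3) (v : TangentSpace (𝓡 3) x) :
    mvfderiv (𝓡 3) (crd i) x v = toR4 x v i := by
  have h1 : MDifferentiableAt 𝓘(ℝ, EuclideanSpace ℝ (Fin 4)) 𝓘(ℝ, ℝ)
    (EuclideanSpace.proj (𝕜 := ℝ) i : EuclideanSpace ℝ (Fin 4) →L[ℝ] ℝ) (x : EuclideanSpace ℝ (Fin 4)) :=
    (EuclideanSpace.proj (𝕜 := ℝ) i).differentiableAt.mdifferentiableAt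
  have h2 : MDifferentiableAt (𝓡 3) 𝓘(ℝ, EuclideanSpace ℝ (Fin 4))
    (fun y : S3 => (y : EuclideanSpace ℝ (Fin 4))) x := contMDiff_coe_S3.mdifferentiableAt (by simp)
  have h3 : mvfderiv (𝓡 3) (crd i) x v = mfderiv (𝓡 3) 𝓘(ℝ, ℝ)
    ((EuclideanSpace.proj (𝕜 := ℝ) i : EuclideanSpace ℝ (Fin 4) →L[ℝ] ℝ) ∘
      (fun y : S3 => (y : EuclideanSpace ℝ (Fin 4)))) x v := rfl
  rw [h3, mfderiv_comp x h1 h2, mfderiv_eq_fderiv, ContinuousLinearMap.fderiv]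
  rfl

theorem mdifferentiableAt_restrict_S3 {F : EuclideanSpace ℝ (Fin 4) → ℝ} {x : S3}
    (hF : DifferentiableAt ℝ F x) : MDifferentiableAt (𝓡 3) 𝓘(ℝ, ℝ) (fun y : S3 => F y) x :=
  MDifferentiableAt.comp x hF.mdifferentiableAt (contMDiff_coe_S3.mdifferentiableAt (by simp))

/-- The inclusion of the sphere in `ℝ⁴` is an immersion. -/
theorem eq_zero_of_mvfderiv_crd (x : S3) (v : TangentSpace (𝓡 3) x)
    (h : ∀ i, mvfderiv (𝓡 3) (crd i) x v = 0) : v = 0 := by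
  have : toR4 x v = toR4 x 0 := by
    rw [map_zero]
    ext i
    rw [← mvfderiv_crd, h]
    rfl
  exact injective_mvfderiv_subtypeVal_sphere x this

theorem crd_sq_sum (x : S3) : (crd 0 x * crd 0 x + crd 1 x * crd 1 x) +
    (crd 2 x * crd 2 x + crd 3 x * crd 3 x) = 1 := by
  have h := EuclideanSpace.real_norm_sq_eq (x : EuclideanSpace ℝ (Fin 4))
  rw [norm_eq_of_mem_sphere, Fin.sum_univ_four] at h
  simp only [crd]
  linarith

theorem sq_norm_zc_zero (x : S3) : ‖zc 0 x‖ ^ 2 = crd 0 x * crd 0 x + crd 1 x * crd 1 x := by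
  rw [Complex.sq_norm, Complex.normSq_apply]
  rfl

theorem sq_norm_zc_one (x : S3) : ‖zc 1 x‖ ^ 2 = crd 2 x * crd 2 x + crd 3 x * crd 3 x := by
  rw [Complex.sq_norm, Complex.normSq_apply]
  rfl

theorem dTheta_zero (x : S3) (v : TangentSpace (𝓡 3) x) : dTheta 0 x v =
    (crd 0 x * mvfderiv (𝓡 3) (crd 1) x v - crd 1 x * mvfderiv (𝓡 3) (crd 0) x v) /
      (crd 0 x * crd 0 x + crd 1 x * crd 1 x) := by
  rw [dTheta, sq_norm_zc_zero, mvfderiv_crd, mvfderiv_crd]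
  simp [zc, crd, Complex.mul_im]
  ring

theorem dTheta_one (x : S3) (v : TangentSpace (𝓡 3) x) : dTheta 1 x v =
    (crd 2 x * mvfderiv (𝓡 3) (crd 3) x v - crd 3 x * mvfderiv (𝓡 3) (crd 2) x v) /
      (crd 2 x * crd 2 x + crd 3 x * crd 3 x) := by
  rw [dTheta, sq_norm_zc_one, mvfderiv_crd, mvfderiv_crd]
  simp [zc, crd, Complex.mul_im]
  ring

theorem mem_thetaLine_zero {x : S3} {v : TangentSpace (𝓡 3) x} (hv : v ∈ thetaLine 0 x) :
    ∃ l : ℝ, mvfderiv (𝓡 3) (crd 0) x v = -(l * crd 1 x) ∧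
      mvfderiv (𝓡 3) (crd 1) x v = l * crd 0 x ∧
      mvfderiv (𝓡 3) (crd 2) x v = 0 ∧ mvfderiv (𝓡 3) (crd 3) x v = 0 := by
  obtain ⟨l, hl⟩ := Submodule.mem_span_singleton.1 (Submodule.mem_comap.1 hv)
  have hl' : toR4 x v = l • ofC2 (Complex.I * zc 0 x) 0 := by simpa using hl.symm
  refine ⟨l, ?_⟩
  simp only [mvfderiv_crd, hl']
  simp [ofC2, zc, crd]

theorem mem_thetaLine_one {x : S3} {v : TangentSpace (𝓡 3) x} (hv : v ∈ thetaLine 1 x) :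
    ∃ l : ℝ, mvfderiv (𝓡 3) (crd 0) x v = 0 ∧ mvfderiv (𝓡 3) (crd 1) x v = 0 ∧
      mvfderiv (𝓡 3) (crd 2) x v = -(l * crd 3 x) ∧
      mvfderiv (𝓡 3) (crd 3) x v = l * crd 2 x := by
  obtain ⟨l, hl⟩ := Submodule.mem_span_singleton.1 (Submodule.mem_comap.1 hv)
  have hl' : toR4 x v = l • ofC2 0 (Complex.I * zc 1 x) := by simpa using hl.symm
  refine ⟨l, ?_⟩
  simp only [mvfderiv_crd, hl']
  simp [ofC2, zc, crd]

theorem mvfderiv_crd_orthogonal (x : S3) (v : TangentSpace (𝓡 3) x) :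
    (crd 0 x * mvfderiv (𝓡 3) (crd 0) x v + crd 1 x * mvfderiv (𝓡 3) (crd 1) x v) +
    (crd 2 x * mvfderiv (𝓡 3) (crd 2) x v + crd 3 x * mvfderiv (𝓡 3) (crd 3) x v) = 0 := by
  have h := mvfderiv_sum_apply Finset.univ
    (fun i => (mdifferentiableAt_crd i x).mul (mdifferentiableAt_crd i x)) v
  have hc : (fun y => ∑ i, (crd i * crd i) y) = fun _ => (1 : ℝ) := by
    funext y
    rw [Fin.sum_univ_four, ← crd_sq_sum y]
    simp only [Pi.mul_apply]
    ring
  have h2 := h.2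
  rw [hc, mvfderiv_const, Fin.sum_univ_four] at h2
  have e := fun i => mvfderiv_mul_apply (mdifferentiableAt_crd i x) (mdifferentiableAt_crd i x) v
  have h3 : (0 : ℝ) = _ := h2
  have e' : ∀ i, mvfderiv (𝓡 3) (crd i * crd i) x v =
    crd i x * mvfderiv (𝓡 3) (crd i) x v + crd i x * mvfderiv (𝓡 3) (crd i) x v := e
  simp only [e'] at h3
  linarith

/-! ### The differential of the radial map. -/

theorem differentiable_zc (j : Fin 2) : Differentiable ℝ (zc j) := by
  have h0 : ∀ i : Fin 4, Differentiable ℝ fun y : EuclideanSpace ℝ (Fin 4) => (y i : ℂ) := fun i =>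
    Complex.ofRealCLM.differentiable.comp (EuclideanSpace.proj (𝕜 := ℝ) i).differentiable
  have h1 : zc j = fun y => if j = 0 then (y 0 : ℂ) + y 1 * Complex.I else
      (y 2 : ℂ) + y 3 * Complex.I := by
    funext y
    unfold zc
    split_ifs <;> exact Complex.mk_eq_add_mul_I _ _
  rw [h1]
  split_ifs
  · exact (h0 0).add ((h0 1).mul_const _)
  · exact (h0 2).add ((h0 3).mul_const _)

/-- The factors by which `radialMap k` multiplies `z 0` and `z 1`. -/
def radialFactor (k : ℝ → ℝ) (j : Fin 2) (y : EuclideanSpace ℝ (Fin 4)) : ℝ :=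
  (if j = 0 then k (‖zc 0 y‖ / ‖zc 1 y‖) else 1) /
    (Real.sqrt (1 + k (‖zc 0 y‖ / ‖zc 1 y‖) ^ 2) * ‖zc j y‖)

section

variable {k : ℝ → ℝ} {x : S3}

theorem eventually_zc_ne_zero (hz : zc 0 x ≠ 0 ∧ zc 1 x ≠ 0) :
    ∀ᶠ y : S3 in 𝓝 x, zc 0 y ≠ 0 ∧ zc 1 y ≠ 0 := by
  have h : ∀ j, Continuous fun y : S3 => zc j y := fun j =>
    (differentiable_zc j).continuous.comp continuous_subtype_val
  exact ((h 0).continuousAt.eventually_ne hz.1).and ((h 1).continuousAt.eventually_ne hz.2)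

theorem differentiableAt_ratio (hz : zc 0 x ≠ 0 ∧ zc 1 x ≠ 0) :
    DifferentiableAt ℝ (fun y => ‖zc 0 y‖ / ‖zc 1 y‖) (x : EuclideanSpace ℝ (Fin 4)) := by
  have h0 := (differentiable_zc 0 x).norm ℝ hz.1
  have h1 := (differentiable_zc 1 x).norm ℝ hz.2
  have hn : ‖zc 1 x‖ ≠ 0 := norm_ne_zero_iff.2 hz.2
  have h := h0.fun_mul (h1.fun_inv hn)
  simpa only [div_eq_mul_inv] using h

theorem differentiableAt_radialFactor (hz : zc 0 x ≠ 0 ∧ zc 1 x ≠ 0)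
    (hk : DifferentiableAt ℝ k (‖zc 0 x‖ / ‖zc 1 x‖)) (j : Fin 2) :
    DifferentiableAt ℝ (radialFactor k j) (x : EuclideanSpace ℝ (Fin 4)) := by
  have hκ : DifferentiableAt ℝ (fun y => k (‖zc 0 y‖ / ‖zc 1 y‖))
      (x : EuclideanSpace ℝ (Fin 4)) := hk.comp (x : EuclideanSpace ℝ (Fin 4)) (differentiableAt_ratio hz)
  have hzj : zc j x ≠ 0 := by
    fin_cases j
    exacts [hz.1, hz.2]
  have hpos : 0 < 1 + k (‖zc 0 x‖ / ‖zc 1 x‖) ^ 2 := by positivity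
  have hden : DifferentiableAt ℝ (fun y => Real.sqrt (1 + k (‖zc 0 y‖ / ‖zc 1 y‖) ^ 2) * ‖zc j y‖)
      (x : EuclideanSpace ℝ (Fin 4)) :=
    (((hκ.pow 2).const_add 1).sqrt hpos.ne').mul ((differentiable_zc j x).norm ℝ hzj)
  have hnum : DifferentiableAt ℝ (fun y => if j = 0 then k (‖zc 0 y‖ / ‖zc 1 y‖) else 1)
      (x : EuclideanSpace ℝ (Fin 4)) := by
    split_ifs
    · exact hκ
    · exact differentiableAt_const _
  have hne : Real.sqrt (1 + k (‖zc 0 x‖ / ‖zc 1 x‖) ^ 2) * ‖zc j x‖ ≠ 0 :=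
    mul_ne_zero (Real.sqrt_ne_zero'.2 hpos) (norm_ne_zero_iff.2 hzj)
  exact hnum.fun_mul (hden.fun_inv hne)

theorem crd_radialMap (hz : zc 0 x ≠ 0 ∧ zc 1 x ≠ 0) :
    crd 0 (radialMap k x) = radialFactor k 0 x * crd 0 x ∧
    crd 1 (radialMap k x) = radialFactor k 0 x * crd 1 x ∧
    crd 2 (radialMap k x) = radialFactor k 1 x * crd 2 x ∧
    crd 3 (radialMap k x) = radialFactor k 1 x * crd 3 x := by
  unfold radialMap crd
  rw [dif_pos hz]
  simp [ofC2, radialFactor, zc, -Complex.ofReal_div, -Complex.ofReal_mul]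

theorem mvfderiv_crd_radialMap (hz : zc 0 x ≠ 0 ∧ zc 1 x ≠ 0)
    (hk : DifferentiableAt ℝ k (‖zc 0 x‖ / ‖zc 1 x‖))
    (hΨ : MDifferentiableAt (𝓡 3) (𝓡 3) (radialMap k) x) (i : Fin 4) (j : Fin 2)
    (hij : ∀ y : S3, zc 0 y ≠ 0 ∧ zc 1 y ≠ 0 →
      crd i (radialMap k y) = radialFactor k j y * crd i y) (v : TangentSpace (𝓡 3) x) :
    mvfderiv (𝓡 3) (crd i) (radialMap k x) (mfderiv (𝓡 3) (𝓡 3) (radialMap k) x v) =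
      radialFactor k j x * mvfderiv (𝓡 3) (crd i) x v +
        crd i x * mvfderiv (𝓡 3) (fun y : S3 => radialFactor k j y) x v := by
  rw [← mvfderiv_comp_apply x (mdifferentiableAt_crd i _) hΨ]
  have hc : crd i ∘ radialMap k =ᶠ[𝓝 x] fun y : S3 => radialFactor k j y * crd i y := by
    filter_upwards [eventually_zc_ne_zero hz] with y hy using hij y hy
  rw [hc.mvfderiv_eq, mvfderiv_mul_apply
    (mdifferentiableAt_restrict_S3 (differentiableAt_radialFactor hz hk j))
    (mdifferentiableAt_crd i x)]

theorem radialFactor_pos (hz : zc 0 x ≠ 0 ∧ zc 1 x ≠ 0) (hk : 0 < k (‖zc 0 x‖ / ‖zc 1 x‖))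
    (j : Fin 2) : 0 < radialFactor k j x := by
  have h0 := norm_pos_iff.2 hz.1
  have h1 := norm_pos_iff.2 hz.2
  have h2 : 0 < Real.sqrt (1 + k (‖zc 0 x‖ / ‖zc 1 x‖) ^ 2) := Real.sqrt_pos.2 (by positivity)
  unfold radialFactor
  fin_cases j <;> simp <;> positivity

/-- The map multiplies `z_j` by a positive real function `m`. In `Im(conj(m z) d(m z))` the `dm`
term is real and drops out, and the remaining factor `m²` cancels against `|m z|²`. -/
theorem dTheta_radialMap (hz : zc 0 x ≠ 0 ∧ zc 1 x ≠ 0)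
    (hk : DifferentiableAt ℝ k (‖zc 0 x‖ / ‖zc 1 x‖)) (hk0 : 0 < k (‖zc 0 x‖ / ‖zc 1 x‖))
    (hΨ : MDifferentiableAt (𝓡 3) (𝓡 3) (radialMap k) x) (j : Fin 2) (v : TangentSpace (𝓡 3) x) :
    dTheta j (radialMap k x) (mfderiv (𝓡 3) (𝓡 3) (radialMap k) x v) = dTheta j x v := by
  have hm := radialFactor_pos hz hk0
  obtain ⟨c0, c1, c2, c3⟩ := crd_radialMap (k := k) hz
  have hs0 : crd 0 x * crd 0 x + crd 1 x * crd 1 x ≠ 0 := by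
    rw [← sq_norm_zc_zero]
    exact pow_ne_zero _ (norm_ne_zero_iff.2 hz.1)
  have hs1 : crd 2 x * crd 2 x + crd 3 x * crd 3 x ≠ 0 := by
    rw [← sq_norm_zc_one]
    exact pow_ne_zero _ (norm_ne_zero_iff.2 hz.2)
  have d0 := mvfderiv_crd_radialMap hz hk hΨ 0 0 (fun y hy => (crd_radialMap hy).1) v
  have d1 := mvfderiv_crd_radialMap hz hk hΨ 1 0 (fun y hy => (crd_radialMap hy).2.1) v
  have d2 := mvfderiv_crd_radialMap hz hk hΨ 2 1 (fun y hy => (crd_radialMap hy).2.2.1) v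
  have d3 := mvfderiv_crd_radialMap hz hk hΨ 3 1 (fun y hy => (crd_radialMap hy).2.2.2) v
  have hm0 := (hm 0).ne'
  have hm1 := (hm 1).ne'
  fin_cases j
  · change dTheta 0 _ _ = dTheta 0 _ _
    rw [dTheta_zero, dTheta_zero, d0, d1, c0, c1, div_eq_div_iff _ hs0]
    · ring
    · have : radialFactor k 0 x * crd 0 x * (radialFactor k 0 x * crd 0 x) +
        radialFactor k 0 x * crd 1 x * (radialFactor k 0 x * crd 1 x) =
        radialFactor k 0 x ^ 2 * (crd 0 x * crd 0 x + crd 1 x * crd 1 x) := by ring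
      rw [this]
      exact mul_ne_zero (pow_ne_zero _ hm0) hs0
  · change dTheta 1 _ _ = dTheta 1 _ _
    rw [dTheta_one, dTheta_one, d2, d3, c2, c3, div_eq_div_iff _ hs1]
    · ring
    · have : radialFactor k 1 x * crd 2 x * (radialFactor k 1 x * crd 2 x) +
        radialFactor k 1 x * crd 3 x * (radialFactor k 1 x * crd 3 x) =
        radialFactor k 1 x ^ 2 * (crd 2 x * crd 2 x + crd 3 x * crd 3 x) := by ring
      rw [this]
      exact mul_ne_zero (pow_ne_zero _ hm1) hs1

/-- The function `|z 0|² / |z 1|²` on the sphere. -/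
def sqRatio (y : S3) : ℝ := (crd 0 y * crd 0 y + crd 1 y * crd 1 y) /
  (crd 2 y * crd 2 y + crd 3 y * crd 3 y)

theorem sqRatio_eq (y : S3) : sqRatio y = (‖zc 0 y‖ / ‖zc 1 y‖) ^ 2 := by
  rw [div_pow, sq_norm_zc_zero, sq_norm_zc_one, sqRatio]

theorem mdifferentiableAt_sqRatio {y : S3} (hy : zc 0 y ≠ 0 ∧ zc 1 y ≠ 0) :
    MDifferentiableAt (𝓡 3) 𝓘(ℝ, ℝ) sqRatio y := by
  have : sqRatio = fun y : S3 => (‖zc 0 y‖ / ‖zc 1 y‖) ^ 2 := funext sqRatio_eq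
  rw [this]
  exact mdifferentiableAt_restrict_S3 (F := fun y => (‖zc 0 y‖ / ‖zc 1 y‖) ^ 2)
    ((differentiableAt_ratio hy).pow 2)

theorem sqRatio_radialMap {y : S3} (hy : zc 0 y ≠ 0 ∧ zc 1 y ≠ 0) :
    sqRatio (radialMap k y) = k (‖zc 0 y‖ / ‖zc 1 y‖) ^ 2 := by
  obtain ⟨c0, c1, c2, c3⟩ := crd_radialMap (k := k) hy
  have h0 : ‖zc 0 y‖ ^ 2 = crd 0 y * crd 0 y + crd 1 y * crd 1 y := sq_norm_zc_zero y
  have h1 : ‖zc 1 y‖ ^ 2 = crd 2 y * crd 2 y + crd 3 y * crd 3 y := sq_norm_zc_one y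
  have hn0 := norm_ne_zero_iff.2 hy.1
  have hn1 := norm_ne_zero_iff.2 hy.2
  have e : sqRatio (radialMap k y) = (radialFactor k 0 y ^ 2 * ‖zc 0 y‖ ^ 2) /
      (radialFactor k 1 y ^ 2 * ‖zc 1 y‖ ^ 2) := by
    rw [sqRatio, c0, c1, c2, c3, h0, h1]
    congr 1 <;> ring
  rw [e]
  have h2 : Real.sqrt (1 + k (‖zc 0 y‖ / ‖zc 1 y‖) ^ 2) ≠ 0 := Real.sqrt_ne_zero'.2 (by positivity)
  unfold radialFactor
  simp only [if_true, one_ne_zero, if_false]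
  field_simp

theorem zc_radialMap_ne_zero (hz : zc 0 x ≠ 0 ∧ zc 1 x ≠ 0)
    (hk0 : 0 < k (‖zc 0 x‖ / ‖zc 1 x‖)) :
    zc 0 (radialMap k x) ≠ 0 ∧ zc 1 (radialMap k x) ≠ 0 := by
  have hm := radialFactor_pos hz hk0
  obtain ⟨c0, c1, c2, c3⟩ := crd_radialMap (k := k) hz
  have hs0 : crd 0 x * crd 0 x + crd 1 x * crd 1 x ≠ 0 := by
    rw [← sq_norm_zc_zero]
    exact pow_ne_zero _ (norm_ne_zero_iff.2 hz.1)
  have hs1 : crd 2 x * crd 2 x + crd 3 x * crd 3 x ≠ 0 := by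
    rw [← sq_norm_zc_one]
    exact pow_ne_zero _ (norm_ne_zero_iff.2 hz.2)
  constructor
  · intro h
    have := sq_norm_zc_zero (radialMap k x)
    rw [h, c0, c1] at this
    have e : radialFactor k 0 x ^ 2 * (crd 0 x * crd 0 x + crd 1 x * crd 1 x) = 0 := by
      simp only [norm_zero] at this
      linear_combination -this
    exact mul_ne_zero (pow_ne_zero _ (hm 0).ne') hs0 e
  · intro h
    have := sq_norm_zc_one (radialMap k x)
    rw [h, c2, c3] at this
    have e : radialFactor k 1 x ^ 2 * (crd 2 x * crd 2 x + crd 3 x * crd 3 x) = 0 := by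
      simp only [norm_zero] at this
      linear_combination -this
    exact mul_ne_zero (pow_ne_zero _ (hm 1).ne') hs1 e

/-- Off the axes, `θ₀`, `θ₁` and `u = |z₀|/|z₁|` are local coordinates. The map preserves the angles
and replaces `u` by `k u` with `k' > 0`, so a vector in the kernel of its differential has no
component left. -/
theorem eq_zero_of_mfderiv_radialMap (hz : zc 0 x ≠ 0 ∧ zc 1 x ≠ 0)
    (hk : DifferentiableAt ℝ k (‖zc 0 x‖ / ‖zc 1 x‖)) (hk0 : 0 < k (‖zc 0 x‖ / ‖zc 1 x‖))
    (hk1 : 0 < deriv k (‖zc 0 x‖ / ‖zc 1 x‖))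
    (hΨ : MDifferentiableAt (𝓡 3) (𝓡 3) (radialMap k) x) {v : TangentSpace (𝓡 3) x}
    (hv : mfderiv (𝓡 3) (𝓡 3) (radialMap k) x v = 0) : v = 0 := by
  have hs0 : crd 0 x * crd 0 x + crd 1 x * crd 1 x ≠ 0 := by
    rw [← sq_norm_zc_zero]
    exact pow_ne_zero _ (norm_ne_zero_iff.2 hz.1)
  have hs1 : crd 2 x * crd 2 x + crd 3 x * crd 3 x ≠ 0 := by
    rw [← sq_norm_zc_one]
    exact pow_ne_zero _ (norm_ne_zero_iff.2 hz.2)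
  -- the angular components vanish
  have hθ : ∀ j, dTheta j x v = 0 := fun j => by
    rw [← dTheta_radialMap hz hk hk0 hΨ, hv, dTheta]
    have : zc j (0 : EuclideanSpace ℝ (Fin 4)) = 0 := by
      unfold zc
      split_ifs <;> rfl
    rw [map_zero, this]
    simp
  have t0 := hθ 0
  have t1 := hθ 1
  rw [dTheta_zero, div_eq_zero_iff, or_iff_left hs0] at t0
  rw [dTheta_one, div_eq_zero_iff, or_iff_left hs1] at t1
  -- the radial component vanishes
  have hu : MDifferentiableAt (𝓡 3) 𝓘(ℝ, ℝ) (fun y : S3 => ‖zc 0 y‖ / ‖zc 1 y‖) x :=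
    mdifferentiableAt_restrict_S3 (differentiableAt_ratio hz)
  obtain ⟨hκ, hκv⟩ := mvfderiv_real_comp (s := fun y : S3 => ‖zc 0 y‖ / ‖zc 1 y‖) hk hu v
  have du : mvfderiv (𝓡 3) (fun y : S3 => ‖zc 0 y‖ / ‖zc 1 y‖) x v = 0 := by
    have h1 := mvfderiv_comp_apply x
      (mdifferentiableAt_sqRatio (zc_radialMap_ne_zero hz hk0)) hΨ v
    rw [hv, map_zero] at h1
    have hc : sqRatio ∘ radialMap k =ᶠ[𝓝 x] fun y : S3 =>
        k (‖zc 0 y‖ / ‖zc 1 y‖) * k (‖zc 0 y‖ / ‖zc 1 y‖) := by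
      filter_upwards [eventually_zc_ne_zero hz] with y hy
      rw [Function.comp_apply, sqRatio_radialMap hy, sq]
    rw [hc.mvfderiv_eq, mvfderiv_mul_apply hκ hκ, ← two_mul, hκv] at h1
    simpa [hk0.ne', hk1.ne'] using h1
  have ds : mvfderiv (𝓡 3) sqRatio x v = 0 := by
    have : sqRatio = fun y : S3 => ‖zc 0 y‖ / ‖zc 1 y‖ * (‖zc 0 y‖ / ‖zc 1 y‖) := by
      funext y
      rw [sqRatio_eq, sq]
    rw [this, mvfderiv_mul_apply hu hu, du]
    ring
  have hsq : ∀ i j : Fin 4, MDifferentiableAt (𝓡 3) 𝓘(ℝ, ℝ)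
      (fun y => crd i y * crd i y + crd j y * crd j y) x ∧
      mvfderiv (𝓡 3) (fun y => crd i y * crd i y + crd j y * crd j y) x v =
        2 * (crd i x * mvfderiv (𝓡 3) (crd i) x v + crd j x * mvfderiv (𝓡 3) (crd j) x v) := by
    intro i j
    have hi := mdifferentiableAt_crd i x
    have hj := mdifferentiableAt_crd j x
    refine ⟨(hi.mul hi).add (hj.mul hj), ?_⟩
    refine (DFunLike.congr_fun (mvfderiv_fun_add (hi.mul hi) (hj.mul hj)) v).trans ?_
    refine (congrArg₂ (· + ·) (mvfderiv_mul_apply hi hi v) (mvfderiv_mul_apply hj hj v)).trans ?_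
    ring
  have hrel : (fun y => crd 0 y * crd 0 y + crd 1 y * crd 1 y) =ᶠ[𝓝 x] fun y =>
      sqRatio y * (crd 2 y * crd 2 y + crd 3 y * crd 3 y) := by
    filter_upwards [eventually_zc_ne_zero hz] with y hy
    have : crd 2 y * crd 2 y + crd 3 y * crd 3 y ≠ 0 := by
      rw [← sq_norm_zc_one]
      exact pow_ne_zero _ (norm_ne_zero_iff.2 hy.2)
    rw [sqRatio, div_mul_cancel₀ _ this]
  have hr : 2 * (crd 0 x * mvfderiv (𝓡 3) (crd 0) x v + crd 1 x * mvfderiv (𝓡 3) (crd 1) x v) =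
      sqRatio x *
        (2 * (crd 2 x * mvfderiv (𝓡 3) (crd 2) x v + crd 3 x * mvfderiv (𝓡 3) (crd 3) x v)) := by
    rw [← (hsq 0 1).2, hrel.mvfderiv_eq,
      mvfderiv_mul_apply (mdifferentiableAt_sqRatio hz) (hsq 2 3).1, ds, (hsq 2 3).2]
    ring
  have ho := mvfderiv_crd_orthogonal x v
  have hq : 0 ≤ sqRatio x := by
    rw [sqRatio_eq]
    positivity
  -- With `q = |z₀|²/|z₁|²` stationary, `d|z₀|² = q d|z₁|²`, while on the sphere `d|z₀|² + d|z₁|² =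
  -- 0`. As `q + 1 > 0`, both vanish.
  have r1 : crd 2 x * mvfderiv (𝓡 3) (crd 2) x v + crd 3 x * mvfderiv (𝓡 3) (crd 3) x v = 0 := by
    have : (sqRatio x + 1) *
        (crd 2 x * mvfderiv (𝓡 3) (crd 2) x v + crd 3 x * mvfderiv (𝓡 3) (crd 3) x v) = 0 := by
      linear_combination ho - hr / 2
    exact (mul_eq_zero.1 this).resolve_left (by positivity)
  have r0 : crd 0 x * mvfderiv (𝓡 3) (crd 0) x v + crd 1 x * mvfderiv (𝓡 3) (crd 1) x v = 0 := by
    linear_combination ho - r1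
  -- A plane vector at a point other than the origin is zero if its angular and radial components
  -- are.
  have plane : ∀ a b p q : ℝ, a * a + b * b ≠ 0 → a * q - b * p = 0 → a * p + b * q = 0 →
      p = 0 ∧ q = 0 := by
    intro a b p q h e1 e2
    constructor
    · refine (mul_eq_zero.1 (?_ : (a * a + b * b) * p = 0)).resolve_left h
      linear_combination a * e2 - b * e1
    · refine (mul_eq_zero.1 (?_ : (a * a + b * b) * q = 0)).resolve_left h
      linear_combination b * e2 + a * e1
  obtain ⟨p0, p1⟩ := plane _ _ _ _ hs0 t0 r0
  obtain ⟨p2, p3⟩ := plane _ _ _ _ hs1 t1 r1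
  refine eq_zero_of_mvfderiv_crd x v fun i => ?_
  fin_cases i
  exacts [p0, p1, p2, p3]

end

/-! ### Members of the family, the size of the tori and the global one-form. -/

theorem IsSmoothFamilyOne.isFoliationOne {n : ℕ} {M : Type*} [TopologicalSpace M]
    [ChartedSpace (EuclideanSpace ℝ (Fin n)) M] [IsManifold (𝓡 n) ∞ M] {J : Set ℝ}
    {L : ℝ → TangentDistribution n M} (hL : IsSmoothFamilyOne J L) {t : ℝ} (ht : t ∈ J) :
    IsFoliationOne (L t) := by
  intro x₀
  obtain ⟨W, hW, hxW, X, hX, hXL⟩ := hL x₀ t ht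
  have hc : Continuous fun x : M => (x, t) := by fun_prop
  have hmaps : ∀ x ∈ (fun x : M => (x, t)) ⁻¹' W, (x, t) ∈ W ∩ univ ×ˢ J := fun x hx =>
    ⟨hx, mem_univ _, ht⟩
  refine ⟨(fun x : M => (x, t)) ⁻¹' W, hW.preimage hc, hxW, fun x => X (x, t), ?_,
    fun x hx => hXL (x, t) (hmaps x hx)⟩
  have hs : ContMDiff (𝓡 n) ((𝓡 n).prod 𝓘(ℝ, ℝ)) ∞ fun x : M => (x, t) :=
    contMDiff_id.prodMk contMDiff_const
  exact hX.comp hs.contMDiffOn hmaps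

/-- Used to exclude that the pull-back in `insertTori` is taken by a junk zero derivative. -/
theorem IsFoliationOne.ne_top {M : Type*} [TopologicalSpace M]
    [ChartedSpace (EuclideanSpace ℝ (Fin 3)) M] [IsManifold (𝓡 3) ∞ M]
    {L : TangentDistribution 3 M} (hL : IsFoliationOne L) (x : M) : L x ≠ ⊤ := by
  intro htop
  obtain ⟨U, -, hxU, X, -, hX⟩ := hL x
  have hs := (hX x hxU).2
  rw [htop] at hs
  have h1 : Module.finrank ℝ (TangentSpace (𝓡 3) x) ≤ 1 :=
    finrank_le_one (X x) fun w => by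
      have : w ∈ (⊤ : Submodule ℝ (TangentSpace (𝓡 3) x)) := Submodule.mem_top
      rw [hs] at this
      exact Submodule.mem_span_singleton.1 this
  have h2 : Module.finrank ℝ (TangentSpace (𝓡 3) x) = 3 := finrank_euclideanSpace_fin
  omega

theorem lt_of_two_mul_gt {t a b : ℝ} (ht : 0 < t) (hb : 0 ≤ b)
    (hab : a ^ 2 + b ^ 2 = 1) (h : t * b < 2 * a) : t ^ 2 / (4 + t ^ 2) < a ^ 2 := by
  rw [div_lt_iff₀ (by positivity)]
  have h1 : (t * b) ^ 2 < (2 * a) ^ 2 := by gcongr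
  nlinarith

/-- The coefficients of the one-form `h(|z 0|²) |z 0|² dθ_0 + h(|z 1|²) |z 1|² dθ_1` with respect to
the differentials of the real coordinates. -/
def formCoeff (h : ℝ → ℝ) : Fin 4 → S3 → ℝ :=
  ![fun y => -(h (crd 0 y * crd 0 y + crd 1 y * crd 1 y) * crd 1 y),
    fun y => h (crd 0 y * crd 0 y + crd 1 y * crd 1 y) * crd 0 y,
    fun y => -(h (crd 2 y * crd 2 y + crd 3 y * crd 3 y) * crd 3 y),
    fun y => h (crd 2 y * crd 2 y + crd 3 y * crd 3 y) * crd 2 y]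

theorem contMDiff_formCoeff {h : ℝ → ℝ} (hh : ContDiff ℝ ∞ h) (i : Fin 4) :
    ContMDiff (𝓡 3) 𝓘(ℝ, ℝ) ∞ (formCoeff h i) := by
  have hs : ∀ i j : Fin 4, ContMDiff (𝓡 3) 𝓘(ℝ, ℝ) ∞
      fun y : S3 => h (crd i y * crd i y + crd j y * crd j y) := fun i j =>
    hh.contMDiff.comp (((contMDiff_crd i).mul (contMDiff_crd i)).add
      ((contMDiff_crd j).mul (contMDiff_crd j)))
  fin_cases i
  · exact ((hs 0 1).mul (contMDiff_crd 1)).neg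
  · exact (hs 0 1).mul (contMDiff_crd 0)
  · exact ((hs 2 3).mul (contMDiff_crd 3)).neg
  · exact (hs 2 3).mul (contMDiff_crd 2)

end

theorem mainTheorem9 (F₀ : TangentDistribution 3 S3) (hF₀ : IsCandelConlon F₀)
    (k : ℝ → ℝ → ℝ) (hk : ∀ t ∈ Icc (0 : ℝ) 1, IsCollapse t (k t)) (hk₀ : ∀ u > 0, k 0 u = u)
    (hF : IsSmoothFamilyOne (Icc (0 : ℝ) 1) (fun t => insertTori t (k t) F₀)) :
    ∀ t ∈ Icc (0 : ℝ) 1, t ≠ 0 → IsMinimizable (insertTori t (k t) F₀) := by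
  intro t ht ht0
  have htpos : 0 < t := lt_of_le_of_ne ht.1 (Ne.symm ht0)
  have hfol : IsFoliationOne (insertTori t (k t) F₀) := hF.isFoliationOne ht
  -- This constant is the value of `|z₀|²` on the torus `2|z₀| = t|z₁|` in the unit sphere, and
  -- symmetrically for `|z₁|²`. Outside the solid torus the value is larger.
  have hc : 0 < t ^ 2 / (4 + t ^ 2) := by positivity
  obtain ⟨h, hh, hinv⟩ := exists_contDiff_eq_inv hc
  have hnorm : ∀ x : S3, ‖zc 0 x‖ ^ 2 + ‖zc 1 x‖ ^ 2 = 1 := fun x => by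
    rw [sq_norm_zc_zero, sq_norm_zc_one, crd_sq_sum]
  have out0 : ∀ x ∉ solidTorus 0 t,
      t ^ 2 / (4 + t ^ 2) < crd 0 x * crd 0 x + crd 1 x * crd 1 x := fun x hx => by
    rw [← sq_norm_zc_zero]
    exact lt_of_two_mul_gt htpos (norm_nonneg _) (hnorm x) (not_le.1 hx)
  have out1 : ∀ x ∉ solidTorus 1 t,
      t ^ 2 / (4 + t ^ 2) < crd 2 x * crd 2 x + crd 3 x * crd 3 x := fun x hx => by
    rw [← sq_norm_zc_one]
    exact lt_of_two_mul_gt htpos (norm_nonneg _)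
      ((add_comm _ _).trans (hnorm x)) (not_le.1 hx)
  -- For `t ≤ 1` the two inequalities would force `z₀ = z₁ = 0`.
  have disj : ∀ x ∈ solidTorus 0 t, x ∉ solidTorus 1 t := by
    intro x h0 h1
    have h0' : 2 * ‖zc 0 x‖ ≤ t * ‖zc 1 x‖ := h0
    have h1' : 2 * ‖zc 1 x‖ ≤ t * ‖zc 0 x‖ := h1
    have n0 := norm_nonneg (zc 0 x)
    have n1 := norm_nonneg (zc 1 x)
    have e0 : t * ‖zc 1 x‖ ≤ ‖zc 1 x‖ := mul_le_of_le_one_left n1 ht.2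
    have e1 : t * ‖zc 0 x‖ ≤ ‖zc 0 x‖ := mul_le_of_le_one_left n0 ht.2
    have hz0 : ‖zc 0 x‖ = 0 := by linarith
    have hz1 : ‖zc 1 x‖ = 0 := by linarith
    have := hnorm x
    rw [hz0, hz1] at this
    norm_num at this
  refine isMinimizable_of_oneForm hfol (fun i => contMDiff_crd i) eq_zero_of_mvfderiv_crd
    (a := formCoeff h) (b := crd) (contMDiff_formCoeff hh) (fun i => contMDiff_crd i) ?_ ?_
  · intro x v hv hv0
    rw [Fin.sum_univ_four]
    change -(h (crd 0 x * crd 0 x + crd 1 x * crd 1 x) * crd 1 x) * _ +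
      h (crd 0 x * crd 0 x + crd 1 x * crd 1 x) * crd 0 x * _ +
      -(h (crd 2 x * crd 2 x + crd 3 x * crd 3 x) * crd 3 x) * _ +
      h (crd 2 x * crd 2 x + crd 3 x * crd 3 x) * crd 2 x * _ ≠ 0
    unfold insertTori at hv
    split_ifs at hv with h0 h1
    · obtain ⟨l, p0, p1, p2, p3⟩ := mem_thetaLine_one hv
      -- Outside the other torus the `θ₁` part of the form is exactly `dθ₁`, with value `l` on `l
      -- ∂/∂θ₁`.
      have hs := out1 x (disj x h0)
      rw [hinv (crd 2 x * crd 2 x + crd 3 x * crd 3 x) (by linarith), p0, p1, p2, p3]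
      have hl : l ≠ 0 := by
        rintro rfl
        refine hv0 (eq_zero_of_mvfderiv_crd x v fun i => ?_)
        fin_cases i <;> simp [p0, p1, p2, p3]
      intro hcon
      apply hl
      have hs' : crd 2 x * crd 2 x + crd 3 x * crd 3 x ≠ 0 := by linarith
      linear_combination hcon - l * mul_inv_cancel₀ hs'
    · obtain ⟨l, p0, p1, p2, p3⟩ := mem_thetaLine_zero hv
      have hs := out0 x h0
      rw [hinv (crd 0 x * crd 0 x + crd 1 x * crd 1 x) (by linarith), p0, p1, p2, p3]
      have hl : l ≠ 0 := by
        rintro rfl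
        refine hv0 (eq_zero_of_mvfderiv_crd x v fun i => ?_)
        fin_cases i <;> simp [p0, p1, p2, p3]
      intro hcon
      apply hl
      have hs' : crd 0 x * crd 0 x + crd 1 x * crd 1 x ≠ 0 := by linarith
      linear_combination hcon - l * mul_inv_cancel₀ hs'
    · have hs0 := out0 x h0
      have hs1 := out1 x h1
      have hz : zc 0 x ≠ 0 ∧ zc 1 x ≠ 0 := by
        constructor
        · intro hz
          rw [← sq_norm_zc_zero, hz, norm_zero] at hs0
          norm_num at hs0
          linarith
        · intro hz
          rw [← sq_norm_zc_one, hz, norm_zero] at hs1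
          norm_num at hs1
          linarith
      obtain ⟨hk1, hk2, hk3⟩ := hk t ht
      have n0 := norm_pos_iff.2 hz.1
      have n1 := norm_pos_iff.2 hz.2
      have hu : ‖zc 0 x‖ / ‖zc 1 x‖ ∈ {u : ℝ | t < 2 * u ∧ t * u < 2} := by
        have h0' : t * ‖zc 1 x‖ < 2 * ‖zc 0 x‖ := not_le.1 h0
        have h1' : t * ‖zc 0 x‖ < 2 * ‖zc 1 x‖ := not_le.1 h1
        constructor
        · rw [← mul_div_assoc, lt_div_iff₀ n1]
          exact h0'
        · rw [← mul_div_assoc, div_lt_iff₀ n1]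
          exact h1'
      have hopen : IsOpen {u : ℝ | t < 2 * u ∧ t * u < 2} :=
        (isOpen_lt continuous_const (continuous_const_mul (2 : ℝ))).inter
          (isOpen_lt (continuous_const_mul t) continuous_const)
      have hkd : DifferentiableAt ℝ (k t) (‖zc 0 x‖ / ‖zc 1 x‖) :=
        (hk1.contDiffAt (hopen.mem_nhds hu)).differentiableAt (by simp)
      have hkpos : 0 < k t (‖zc 0 x‖ / ‖zc 1 x‖) := hk3.mapsTo hu
      -- Otherwise `mfderiv` would be `0` by convention and the pulled-back plane field would be the
      -- whole tangent space, which is not a line.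
      have hΨ : MDifferentiableAt (𝓡 3) (𝓡 3) (radialMap (k t)) x := by
        by_contra hnot
        refine hfol.ne_top x ?_
        unfold insertTori
        rw [if_neg h0, if_neg h1, mfderiv_zero_of_not_mdifferentiableAt hnot]
        ext w
        simp
      have hw : mfderiv (𝓡 3) (𝓡 3) (radialMap (k t)) x v ≠ 0 := fun hcon =>
        hv0 (eq_zero_of_mfderiv_radialMap hz hkd hkpos (hk2 _ hu) hΨ hcon)
      have hz' := zc_radialMap_ne_zero hz hkpos
      have hfin := hF₀.transverse _ hz'.1 hz'.2 _ hv hw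
      erw [dTheta_radialMap hz hkd hkpos hΨ, dTheta_radialMap hz hkd hkpos hΨ] at hfin
      rw [dTheta_zero, dTheta_one, div_eq_mul_inv, div_eq_mul_inv, ← hinv _ (by linarith),
        ← hinv _ (by linarith)] at hfin
      refine fun hcon => hfin ?_
      linear_combination hcon
  · intro x v hv w
    have hd : Differentiable ℝ h := hh.differentiable (by simp)
    -- Inside the torus around `A₀` the leaves have constant `z₀`; outside it `s h(s) = 1` near `s =
    -- |z₀|²`.
    have c0 : h (crd 0 x * crd 0 x + crd 1 x * crd 1 x) + (crd 0 x * crd 0 x + crd 1 x * crd 1 x) *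
        deriv h (crd 0 x * crd 0 x + crd 1 x * crd 1 x) = 0 ∨
        (mvfderiv (𝓡 3) (crd 0) x v = 0 ∧ mvfderiv (𝓡 3) (crd 1) x v = 0) := by
      by_cases h0 : x ∈ solidTorus 0 t
      · rw [insertTori, if_pos h0] at hv
        obtain ⟨l, p0, p1, -⟩ := mem_thetaLine_one hv
        exact Or.inr ⟨p0, p1⟩
      · exact Or.inl (add_mul_deriv_eq_zero_of_eq_inv hc hinv (out0 x h0))
    have c1 : h (crd 2 x * crd 2 x + crd 3 x * crd 3 x) + (crd 2 x * crd 2 x + crd 3 x * crd 3 x) *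
        deriv h (crd 2 x * crd 2 x + crd 3 x * crd 3 x) = 0 ∨
        (mvfderiv (𝓡 3) (crd 2) x v = 0 ∧ mvfderiv (𝓡 3) (crd 3) x v = 0) := by
      by_cases h1 : x ∈ solidTorus 1 t
      · rw [insertTori, if_neg fun h0 => disj x h0 h1, if_pos h1] at hv
        obtain ⟨l, -, -, p2, p3⟩ := mem_thetaLine_zero hv
        exact Or.inr ⟨p2, p3⟩
      · exact Or.inl (add_mul_deriv_eq_zero_of_eq_inv hc hinv (out1 x h1))
    have e0 := angularForm_closed (mdifferentiableAt_crd 0 x) (mdifferentiableAt_crd 1 x)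
      (hd _) v w c0
    have e1 := angularForm_closed (mdifferentiableAt_crd 2 x) (mdifferentiableAt_crd 3 x)
      (hd _) v w c1
    rw [Fin.sum_univ_four]
    refine Eq.trans ?_ ((congrArg₂ (· + ·) e0 e1).trans (add_zero 0))
    exact add_assoc _ _ _
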